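/- Let $D$ be a division ring of characteristic $3$ that is finite-dimensional over its centre $C$, of degree $n$, i.e. $[D:C]=n^2$ (the case $D=C$ is allowed). Let $\delta$ be a derivation of $D$, put $F=\{a\in C \mid \delta(a)=0\}$, and suppose that $\delta|_C$, as an $F$-linear endomorphism of $C$, has minimum polynomial $g(t)=t^3-ct\in F[t]$. Let $D[t;\delta]$ be the differential polynomial ring, whose elements are the polynomials $\sum a_it^i$ with $a_i\in D$ and in which $ta=at+\delta(a)$ for $a\in D$. For $z\in D$ let $V_3(z)\in D$ be defined by $(t-z)^3=t^3-V_3(z)$ in $D[t;\delta]$. For $d\in D$ put $f(t)=t^3-ct-d\in D[t;\delta]$, and let $$(D,\delta,d)=D[t;\delta]/D[t;\delta]f(t)$$ denote the set of all $g\in D[t;\delta]$ of degree less than $3$ with the usual addition and the multiplication $g\circ h=gh \bmod_r f$, the remainder of $gh$ on right division by $f$ (that is, $gh=qf+(g\circ h)$ with $\deg (g\circ h)<3$). Then for every $d\in D$: 1. $(D,\delta,d)$ is a unital nonassociative (i.e. not necessarily associative) algebra over $F$ of dimension $9n^2$. 2. $(D,\delta,d)$ is a division algebra (it is nonzero, and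 all left and right multiplications by nonzero elements are bijective) if and only if $$V_3(z)-cz\neq d \quad\text{and}\quad V_3(z)-zc-d+\delta(c)\neq 0\qquad\text{for all } z\in D.$$ 3. If $g(\delta)=0$ on all of $D$, i.e. $\delta^3(x)=c\,\delta(x)$ for all $x\in D$ (which is automatic when $D=C$), then $(D,\delta,d)$ is associative if and only if $d\in F$. 4. The group $\mathrm{Aut}_F((D,\delta,d))$ of $F$-algebra automorphisms has a subgroup isomorphic to the additive group $\{\delta(u)/u \mid u\in C,\ u\neq 0\}$ of logarithmic derivatives. -/

import Mathlib

/-- A derivation of a (not necessarily commutative) ring: an additive map satisfying the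
Leibniz rule. -/
structure RingDerivation (D : Type*) [Ring D] extends D →+ D where
  leibniz' : ∀ a b : D, toFun (a * b) = a * toFun b + toFun a * b

namespace RingDerivation

variable {D : Type*}

instance instFunLike [Ring D] : FunLike (RingDerivation D) D D where
  coe δ := δ.toFun
  coe_injective := by
    rintro ⟨f, hf⟩ ⟨g, hg⟩ h
    congr
    exact DFunLike.coe_injective h

instance instAddMonoidHomClass [Ring D] : AddMonoidHomClass (RingDerivation D) D D where
  map_add δ := δ.map_add'
  map_zero δ := δ.map_zero'

theorem leibniz [Ring D] (δ : RingDerivation D) (a b : D) :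
    δ (a * b) = a * δ b + δ a * b := δ.leibniz' a b

theorem map_one_eq_zero [Ring D] (δ : RingDerivation D) : δ 1 = 0 := by
  have h := δ.leibniz 1 1
  simpa using h

/-- A derivation maps the centre to itself. -/
theorem map_mem_center [Ring D] (δ : RingDerivation D) {a : D} (ha : a ∈ Subring.center D) :
    δ a ∈ Subring.center D := by
  rw [Subring.mem_center_iff] at ha ⊢
  intro x
  have h := congrArg δ (ha x)
  rw [δ.leibniz, δ.leibniz, ha (δ x)] at h
  rw [add_comm] at h
  exact add_left_cancel h

variable [DivisionRing D]

/-- The field `F = C ∩ Const(δ)` of central constants, as a subfield of the centre `C` of `D`. -/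
def constField (δ : RingDerivation D) : Subfield (Subring.center D) where
  carrier := {a | δ (a : D) = 0}
  mul_mem' := by
    intro a b ha hb
    simp only [Set.mem_ofPred_eq] at ha hb ⊢
    simp [δ.leibniz, ha, hb]
  one_mem' := by simp [map_one_eq_zero]
  add_mem' := by
    intro a b ha hb
    simp only [Set.mem_ofPred_eq] at ha hb ⊢
    simp [ha, hb]
  zero_mem' := by simp
  neg_mem' := by
    intro a ha
    simp only [Set.mem_ofPred_eq] at ha ⊢
    simp [ha]
  inv_mem' := by
    intro a ha
    simp only [Set.mem_ofPred_eq] at ha ⊢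
    rcases eq_or_ne a 0 with rfl | h0
    · simp
    have h0' : (a : D) ≠ 0 := fun h => h0 (Subtype.ext h)
    have h1 : (a : D) * ((a⁻¹ : Subring.center D) : D) = 1 := by
      have := congrArg (Subtype.val) (mul_inv_cancel₀ h0)
      simpa using this
    have h2 := congrArg δ h1
    rw [δ.leibniz, ha, δ.map_one_eq_zero, zero_mul, add_zero] at h2
    exact (mul_eq_zero.mp h2).resolve_left h0'

/-- The restriction `δ|_C` of `δ` to the centre `C`, as an `F`-linear map. -/
def onCenter (δ : RingDerivation D) :
    Subring.center D →ₗ[δ.constField] Subring.center D where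
  toFun a := ⟨δ (a : D), δ.map_mem_center a.2⟩
  map_add' a b := by ext; simp
  map_smul' r a := by
    ext
    have hr : δ ((r : Subring.center D) : D) = 0 := r.2
    simp [Subfield.smul_def, δ.leibniz, hr]

/-- The additive group `{δ(u)/u | u ∈ C, u ≠ 0}` of logarithmic derivatives. -/
def logDerivatives (δ : RingDerivation D) : AddSubgroup (Subring.center D) where
  carrier := {a | ∃ u : Subring.center D, u ≠ 0 ∧ a = δ.onCenter u / u}
  add_mem' := by
    rintro a b ⟨u, hu, rfl⟩ ⟨v, hv, rfl⟩
    refine ⟨u * v, mul_ne_zero hu hv, ?_⟩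
    have h : δ.onCenter (u * v) = u * δ.onCenter v + δ.onCenter u * v := by
      ext; simp [onCenter, δ.leibniz]
    rw [h]
    field_simp
    ring
  zero_mem' := by
    refine ⟨1, one_ne_zero, ?_⟩
    have h : δ.onCenter 1 = 0 := by ext; simp [onCenter, map_one_eq_zero]
    simp [h]
  neg_mem' := by
    rintro a ⟨u, hu, rfl⟩
    refine ⟨u⁻¹, inv_ne_zero hu, ?_⟩
    have h : δ.onCenter (u * u⁻¹) = u * δ.onCenter u⁻¹ + δ.onCenter u * u⁻¹ := by
      ext; simp [onCenter, δ.leibniz]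
    have h1 : δ.onCenter 1 = 0 := by ext; simp [onCenter, map_one_eq_zero]
    rw [mul_inv_cancel₀ hu, h1] at h
    have h2 : δ.onCenter u⁻¹ = - (δ.onCenter u * u⁻¹) / u := by
      field_simp
      field_simp at h
      linear_combination -h
    rw [h2]
    field_simp

end RingDerivation

/-- The differential polynomial ring `D[t;δ]`. Its elements are the left polynomials
`∑ aᵢ tⁱ`, with termwise addition; the multiplication, determined by `t a = a t + δ(a)`, is
defined below. -/
def DiffPoly {D : Type*} [Ring D] (_δ : RingDerivation D) : Type _ := Polynomial D

namespace DiffPoly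

variable {D : Type*}

section ring

variable [Ring D] (δ : RingDerivation D)

noncomputable instance instAddCommGroup : AddCommGroup (DiffPoly δ) :=
  inferInstanceAs (AddCommGroup (Polynomial D))

/-- The underlying left polynomial (the family of coefficients). -/
noncomputable def toPoly {δ : RingDerivation D} : DiffPoly δ ≃+ Polynomial D := AddEquiv.refl _

/-- The constant polynomial `a`. -/
noncomputable def const (a : D) : DiffPoly δ := toPoly.symm (Polynomial.C a)

/-- The variable `t`. -/
noncomputable def t : DiffPoly δ := toPoly.symm Polynomial.X

/-- Left multiplication by `t`: `t · ∑ bⱼ tʲ = ∑ (bⱼ tʲ⁺¹ + δ(bⱼ) tʲ)`. -/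
noncomputable def tMul : AddMonoid.End (Polynomial D) where
  toFun q := Polynomial.X * q + q.sum fun j b => Polynomial.monomial j (δ b)
  map_zero' := by simp
  map_add' p q := by
    rw [Polynomial.sum_add_index] <;> simp [mul_add, add_assoc, add_left_comm]

/-- Left multiplication by `∑ aᵢ tⁱ`: `q ↦ ∑ aᵢ · tⁱ q`. -/
noncomputable def leftMul : Polynomial D →+ AddMonoid.End (Polynomial D) where
  toFun p := p.sum fun i a => AddMonoid.End.mulLeft (Polynomial.C a) * (tMul δ) ^ i
  map_zero' := by simp
  map_add' p q := by
    rw [Polynomial.sum_add_index]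
    · intro i; ext1 x; simp
    · intro i a b; ext1 x; simp [add_mul]

noncomputable instance instMul : Mul (DiffPoly δ) :=
  ⟨fun p q => toPoly.symm (leftMul δ (toPoly p) (toPoly q))⟩

noncomputable instance instOne : One (DiffPoly δ) := ⟨const δ 1⟩

theorem tMul_apply (q : Polynomial D) :
    tMul δ q = Polynomial.X * q + q.sum fun j b => Polynomial.monomial j (δ b) := rfl

theorem coeff_tMul_zero (q : Polynomial D) : (tMul δ q).coeff 0 = δ (q.coeff 0) := by
  simp only [tMul_apply, Polynomial.coeff_add,
    Polynomial.coeff_X_mul_zero, zero_add, Polynomial.sum_def, Polynomial.finsetSum_coeff,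
    Polynomial.coeff_monomial]
  rw [Finset.sum_ite_eq' q.support 0 (fun j => δ (q.coeff j))]
  split_ifs with h
  · rfl
  · simp [Polynomial.notMem_support_iff.mp h]

theorem coeff_tMul_succ (q : Polynomial D) (k : ℕ) :
    (tMul δ q).coeff (k + 1) = q.coeff k + δ (q.coeff (k + 1)) := by
  simp only [tMul_apply, Polynomial.coeff_add,
    Polynomial.coeff_X_mul, Polynomial.sum_def, Polynomial.finsetSum_coeff,
    Polynomial.coeff_monomial]
  rw [Finset.sum_ite_eq' q.support (k + 1) (fun j => δ (q.coeff j))]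
  split_ifs with h
  · rfl
  · simp [Polynomial.notMem_support_iff.mp h]

theorem tMul_C_mul (a : D) (q : Polynomial D) :
    tMul δ (Polynomial.C a * q) = Polynomial.C a * tMul δ q + Polynomial.C (δ a) * q := by
  ext k
  cases k with
  | zero => simp [coeff_tMul_zero, δ.leibniz]
  | succ k => simp [coeff_tMul_succ, δ.leibniz, mul_add, add_assoc]

theorem leftMul_monomial (i : ℕ) (a : D) (q : Polynomial D) :
    leftMul δ (Polynomial.monomial i a) q = Polynomial.C a * ((tMul δ) ^ i) q := by
  change (Polynomial.sum (Polynomial.monomial i a)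
    fun i a => AddMonoid.End.mulLeft (Polynomial.C a) * (tMul δ) ^ i) q = _
  rw [Polynomial.sum_monomial_index]
  · rfl
  · ext1 x; simp

theorem leftMul_add (p₁ p₂ q : Polynomial D) :
    leftMul δ (p₁ + p₂) q = leftMul δ p₁ q + leftMul δ p₂ q :=
  DFunLike.congr_fun ((leftMul δ).map_add p₁ p₂) q

theorem leftMul_C (a : D) (q : Polynomial D) :
    leftMul δ (Polynomial.C a) q = Polynomial.C a * q := by
  have h := leftMul_monomial δ 0 a q
  simpa using h

theorem leftMul_X (q : Polynomial D) : leftMul δ Polynomial.X q = tMul δ q := by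
  have h := leftMul_monomial δ 1 1 q
  simpa [Polynomial.monomial_one_one_eq_X] using h

theorem leftMul_C_mul (a : D) (p q : Polynomial D) :
    leftMul δ (Polynomial.C a * p) q = Polynomial.C a * leftMul δ p q := by
  induction p using Polynomial.induction_on' with
  | add p₁ p₂ h₁ h₂ => simp only [mul_add, leftMul_add, h₁, h₂]
  | monomial i b =>
    rw [Polynomial.C_mul_monomial, leftMul_monomial, leftMul_monomial, Polynomial.C_mul, mul_assoc]

theorem tMul_monomial (i : ℕ) (b : D) :
    tMul δ (Polynomial.monomial i b)
      = Polynomial.monomial (i + 1) b + Polynomial.monomial i (δ b) := by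
  ext k
  cases k with
  | zero => simp [coeff_tMul_zero, Polynomial.coeff_monomial, apply_ite δ]
  | succ k =>
    rw [coeff_tMul_succ]
    simp [Polynomial.coeff_monomial, apply_ite δ]

theorem leftMul_tMul (p q : Polynomial D) :
    leftMul δ (tMul δ p) q = tMul δ (leftMul δ p q) := by
  induction p using Polynomial.induction_on' with
  | add p₁ p₂ h₁ h₂ => rw [map_add, leftMul_add, h₁, h₂, leftMul_add, map_add]
  | monomial i b =>
    rw [tMul_monomial, leftMul_add, leftMul_monomial, leftMul_monomial,
      leftMul_monomial, tMul_C_mul, pow_succ']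
    rfl

theorem leftMul_tMul_pow (i : ℕ) (p q : Polynomial D) :
    leftMul δ (((tMul δ) ^ i) p) q = ((tMul δ) ^ i) (leftMul δ p q) := by
  induction i with
  | zero => rfl
  | succ i ih =>
    rw [pow_succ']
    change leftMul δ (tMul δ (((tMul δ) ^ i) p)) q = tMul δ (((tMul δ) ^ i) (leftMul δ p q))
    rw [leftMul_tMul, ih]

theorem leftMul_assoc (p q r : Polynomial D) :
    leftMul δ (leftMul δ p q) r = leftMul δ p (leftMul δ q r) := by
  induction p using Polynomial.induction_on' with
  | add p₁ p₂ h₁ h₂ => rw [leftMul_add, leftMul_add, h₁, h₂, leftMul_add]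
  | monomial i b =>
    rw [leftMul_monomial, leftMul_monomial, leftMul_C_mul, leftMul_tMul_pow]

theorem tMul_pow_one (i : ℕ) : ((tMul δ) ^ i) (1 : Polynomial D) = Polynomial.X ^ i := by
  induction i with
  | zero => simp
  | succ i ih =>
    rw [pow_succ']
    change tMul δ (((tMul δ) ^ i) 1) = _
    rw [ih, ← Polynomial.monomial_one_right_eq_X_pow, tMul_monomial, δ.map_one_eq_zero]
    simp [Polynomial.monomial_one_right_eq_X_pow]

theorem leftMul_one (p : Polynomial D) : leftMul δ p 1 = p := by
  induction p using Polynomial.induction_on' with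
  | add p₁ p₂ h₁ h₂ => rw [leftMul_add, h₁, h₂]
  | monomial i b => rw [leftMul_monomial, tMul_pow_one, Polynomial.C_mul_X_pow_eq_monomial]

noncomputable instance instRing : Ring (DiffPoly δ) :=
  { instAddCommGroup δ, instMul δ, instOne δ with
    left_distrib := fun p q r => (leftMul δ (toPoly p)).map_add (toPoly q) (toPoly r)
    right_distrib := fun p q r =>
      DFunLike.congr_fun ((leftMul δ).map_add (toPoly p) (toPoly q)) (toPoly r)
    zero_mul := fun p => DFunLike.congr_fun ((leftMul δ).map_zero) (toPoly p)
    mul_zero := fun p => (leftMul δ (toPoly p)).map_zero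
    mul_assoc := fun p q r => leftMul_assoc δ (toPoly p) (toPoly q) (toPoly r)
    one_mul := fun p => by
      change leftMul δ (Polynomial.C 1) (toPoly p) = p
      rw [leftMul_C, Polynomial.C_1, one_mul]
      rfl
    mul_one := fun p => by
      change leftMul δ (toPoly p) (Polynomial.C 1) = p
      rw [Polynomial.C_1, leftMul_one]
      rfl }

theorem toPoly_mul (p q : DiffPoly δ) :
    toPoly (p * q) = leftMul δ (toPoly p) (toPoly q) := rfl

theorem toPoly_const_mul (a : D) (q : DiffPoly δ) :
    toPoly (const δ a * q) = Polynomial.C a * toPoly q := leftMul_C δ a (toPoly q)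

theorem toPoly_t_pow (k : ℕ) : toPoly (t δ ^ k) = Polynomial.X ^ k := by
  induction k with
  | zero => exact Polynomial.C_1
  | succ k ih =>
    rw [pow_succ', toPoly_mul, ih]
    change leftMul δ Polynomial.X _ = _
    rw [leftMul_X, ← tMul_pow_one δ k, ← tMul_pow_one δ (k + 1), pow_succ']
    rfl

/-- The defining relation `t a = a t + δ(a)`. -/
theorem t_mul_const (a : D) : t δ * const δ a = const δ a * t δ + const δ (δ a) := by
  apply toPoly.injective
  rw [map_add, toPoly_const_mul, toPoly_mul]
  change leftMul δ Polynomial.X (Polynomial.C a) = Polynomial.C a * Polynomial.X + Polynomial.C (δ a)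
  rw [leftMul_X, ← mul_one (Polynomial.C a), tMul_C_mul]
  simp [← Polynomial.C_1, ← Polynomial.monomial_zero_left, tMul_monomial, δ.map_one_eq_zero]
  simp [Polynomial.monomial_one_one_eq_X]

theorem const_mul_const (a b : D) : const δ a * const δ b = const δ (a * b) := by
  apply toPoly.injective
  rw [toPoly_const_mul]
  exact Polynomial.C_mul.symm

theorem const_add (a b : D) : const δ (a + b) = const δ a + const δ b :=
  toPoly.injective Polynomial.C_add

theorem const_sub (a b : D) : const δ (a - b) = const δ a - const δ b :=
  toPoly.injective Polynomial.C_sub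

/-- The element `V_p(b) ∈ D` given by `(t - b)^p = t^p - V_p(b)` in `D[t;δ]`, for `D` of
characteristic `p`. -/
noncomputable def V (p : ℕ) (b : D) : D :=
  (toPoly (t δ ^ p - (t δ - const δ b) ^ p)).coeff 0

/-- `(t - b)³ = t³ - (b³ + δ²(b) + bδ(b) - δ(b)b)` in characteristic 3. -/
theorem t_sub_const_pow_three [CharP D 3] (b : D) :
    (t δ - const δ b) ^ 3
      = t δ ^ 3 - const δ (b ^ 3 + δ (δ b) + b * δ b - δ b * b) := by
  have h3D : ((3 : ℕ) : D) = 0 := CharP.cast_eq_zero D 3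
  have h3 : (3 : DiffPoly δ) = 0 := by
    have : (3 : DiffPoly δ) = const δ ((3 : ℕ) : D) := by
      have h1 : (1 : DiffPoly δ) = const δ 1 := rfl
      have e : (3 : DiffPoly δ) = 1 + 1 + 1 := by norm_num
      rw [e, h1, ← const_add, ← const_add]
      norm_num
    rw [this, h3D]
    exact toPoly.injective Polynomial.C_0
  have r := t_mul_const δ
  have e1 : t δ * (t δ * const δ b) = const δ b * (t δ * t δ) + const δ (δ b) * t δ
      + const δ (δ b) * t δ + const δ (δ (δ b)) := by
    rw [r, mul_add, ← mul_assoc, r, r, add_mul, mul_assoc]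
    abel
  have e2 : t δ * const δ b * const δ b
      = const δ (b * b) * t δ + const δ (b * δ b) + const δ (δ b * b) := by
    rw [r, add_mul, mul_assoc, r, mul_add, ← mul_assoc]
    simp only [const_mul_const]
  have e : (t δ - const δ b) ^ 3 = t δ ^ 3 - (t δ * (t δ * const δ b)
      + t δ * const δ b * t δ + const δ b * (t δ * t δ))
      + (t δ * const δ b * const δ b + const δ b * (t δ * const δ b)
      + const δ b * const δ b * t δ) - const δ b * const δ b * const δ b := by
    noncomm_ring
  rw [e, e1, e2, r]
  simp only [const_mul_const, const_add, const_sub, add_mul, mul_add, ← mul_assoc, pow_succ,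
    pow_zero, one_mul]
  have k1 : ∀ x : DiffPoly δ, x + x + x = 0 := fun x => by
    have : x + x + x = 3 * x := by noncomm_ring
    rw [this, h3, zero_mul]
  have k3 : ∀ x y w : DiffPoly δ, x + x + x = 0 → y = w + (x + x + x) → y = w := by
    intro x y w h h'
    rw [h', h, add_zero]
  refine k3 _ _ _ (k1 (-(const δ b * t δ * t δ) - const δ (δ b) * t δ
    + const δ (b * b) * t δ)) ?_
  rw [eq_comm, ← sub_eq_zero]
  refine Eq.trans ?_ (neg_eq_zero.mpr (k1 (const δ (b * δ b))))
  abel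

theorem V_three [CharP D 3] (b : D) :
    V δ 3 b = b ^ 3 + δ (δ b) + b * δ b - δ b * b := by
  rw [V, t_sub_const_pow_three, sub_sub_cancel]
  exact Polynomial.coeff_C_zero

theorem sub_eq (p q : DiffPoly δ) : toPoly (p - q) = toPoly p - toPoly q := map_sub toPoly p q

end ring

/-! Right division with remainder. -/
section division

variable [DivisionRing D] {δ : RingDerivation D}

/-- `f` has leading coefficient 1. -/
def Monic (f : DiffPoly δ) : Prop := (toPoly f).Monic

/-- The degree of `f`. -/
noncomputable def natDegree (f : DiffPoly δ) : ℕ := (toPoly f).natDegree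

theorem natDegree_tMul_le (q : Polynomial D) : (tMul δ q).natDegree ≤ q.natDegree + 1 := by
  rw [Polynomial.natDegree_le_iff_coeff_eq_zero]
  intro k hk
  obtain ⟨k, rfl⟩ : ∃ j, k = j + 1 := ⟨k - 1, by omega⟩
  rw [coeff_tMul_succ, Polynomial.coeff_eq_zero_of_natDegree_lt (by omega),
    Polynomial.coeff_eq_zero_of_natDegree_lt (by omega)]
  simp

theorem monic_tMul_pow {f : Polynomial D} (hf : f.Monic) (k : ℕ) :
    (((tMul δ) ^ k) f).Monic ∧ (((tMul δ) ^ k) f).natDegree = f.natDegree + k := by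
  induction k with
  | zero => exact ⟨hf, rfl⟩
  | succ k ih =>
    obtain ⟨h1, h2⟩ := ih
    rw [pow_succ']
    change (tMul δ (((tMul δ) ^ k) f)).Monic ∧ (tMul δ (((tMul δ) ^ k) f)).natDegree = _
    generalize ((tMul δ) ^ k) f = g at h1 h2
    have hle := natDegree_tMul_le (δ := δ) g
    have hc : (tMul δ g).coeff (g.natDegree + 1) = 1 := by
      rw [coeff_tMul_succ, h1.coeff_natDegree,
        Polynomial.coeff_eq_zero_of_natDegree_lt (Nat.lt_succ_self _)]
      simp
    refine ⟨Polynomial.monic_of_natDegree_le_of_coeff_eq_one _ hle hc, ?_⟩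
    rw [← add_assoc, ← h2]
    refine le_antisymm hle (Polynomial.le_natDegree_of_ne_zero ?_)
    rw [hc]
    exact one_ne_zero

theorem coeff_leftMul_top (q : Polynomial D) {f : Polynomial D} (hf : f.Monic) :
    (leftMul δ q f).coeff (f.natDegree + q.natDegree) = q.leadingCoeff := by
  have h : ∀ s : ℕ, ∀ q : Polynomial D, q.natDegree ≤ s →
      (leftMul δ q f).coeff (f.natDegree + s) = q.coeff s := by
    intro s
    induction s with
    | zero =>
      intro q hq
      rw [Polynomial.eq_C_of_natDegree_le_zero hq, leftMul_C]
      simp [hf.coeff_natDegree]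
    | succ s ih =>
      intro q hq
      have hlow : ∀ q : Polynomial D, q.natDegree ≤ s →
          (leftMul δ q f).coeff (f.natDegree + (s + 1)) = 0 := by
        intro q _
        have e : leftMul δ q f = ∑ i ∈ Finset.range (s + 1),
            leftMul δ (Polynomial.monomial i (q.coeff i)) f := by
          conv_lhs => rw [q.as_sum_range' (s + 1) (by omega), map_sum]
          exact AddMonoidHom.finsetSum_apply _ _ _
        rw [e, Polynomial.finsetSum_coeff]
        refine Finset.sum_eq_zero fun i hi => ?_
        have hi' := Finset.mem_range.mp hi
        have hz : ((tMul δ ^ i) f).coeff (f.natDegree + (s + 1)) = 0 := by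
          apply Polynomial.coeff_eq_zero_of_natDegree_lt
          rw [(monic_tMul_pow hf i).2]
          omega
        rw [leftMul_monomial, Polynomial.coeff_C_mul, hz, mul_zero]
      have hdec : q = (q - Polynomial.monomial (s + 1) (q.coeff (s + 1)))
          + Polynomial.monomial (s + 1) (q.coeff (s + 1)) := by abel
      have hd : (q - Polynomial.monomial (s + 1) (q.coeff (s + 1))).natDegree ≤ s := by
        rw [Polynomial.natDegree_le_iff_coeff_eq_zero]
        intro k hk
        rw [Polynomial.coeff_sub, Polynomial.coeff_monomial]
        split_ifs with h
        · rw [h, sub_self]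
        · rw [Polynomial.coeff_eq_zero_of_natDegree_lt (by omega), sub_zero]
      have hm := monic_tMul_pow (δ := δ) hf (s + 1)
      rw [hdec, leftMul_add, Polynomial.coeff_add, hlow _ hd, leftMul_monomial,
        Polynomial.coeff_C_mul, ← hm.2, hm.1.coeff_natDegree]
      simp
  exact h q.natDegree q le_rfl

/-- Right division: for monic `f` every `g` is uniquely `q f + r` with `deg r < deg f`. -/
theorem existsUnique_remainder {f : DiffPoly δ} (hf : f.Monic) (g : DiffPoly δ) :
    ∃! r : Polynomial.degreeLT D f.natDegree, ∃ q : DiffPoly δ, g = q * f + toPoly.symm r := by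
  have hex : ∀ N : ℕ, ∀ g : DiffPoly δ, (toPoly g).degree < (N : WithBot ℕ) →
      ∃ r : Polynomial.degreeLT D f.natDegree, ∃ q : DiffPoly δ, g = q * f + toPoly.symm r := by
    intro N
    induction N with
    | zero =>
      intro g hg
      refine ⟨⟨toPoly g, Polynomial.mem_degreeLT.mpr (hg.trans_le ?_)⟩, 0, ?_⟩
      · exact_mod_cast Nat.zero_le _
      · simp
    | succ N ih =>
      intro g hg
      rcases lt_or_ge N f.natDegree with hN | hN
      · refine ⟨⟨toPoly g, Polynomial.mem_degreeLT.mpr (hg.trans_le ?_)⟩, 0, ?_⟩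
        · exact_mod_cast hN
        · simp
      · obtain ⟨k, rfl⟩ := Nat.exists_eq_add_of_le hN
        have hm := monic_tMul_pow (δ := δ) hf k
        let a := (toPoly g).coeff (f.natDegree + k)
        let u : DiffPoly δ := toPoly.symm (Polynomial.monomial k a)
        have hu : toPoly (u * f) = Polynomial.C a * ((tMul δ) ^ k) (toPoly f) :=
          leftMul_monomial δ k a (toPoly f)
        obtain ⟨r, q, h⟩ := ih (g - u * f) (by
          rw [Polynomial.degree_lt_iff_coeff_zero]
          intro j hj
          rw [sub_eq, hu, Polynomial.coeff_sub, Polynomial.coeff_C_mul]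
          rcases hj.eq_or_lt with h | h
          · have h' : j = (((tMul δ) ^ k) (toPoly f)).natDegree := by rw [hm.2, ← h]; rfl
            rw [h', hm.1.coeff_natDegree, ← h', ← h, mul_one, sub_self]
          · rw [Polynomial.coeff_eq_zero_of_degree_lt, Polynomial.coeff_eq_zero_of_natDegree_lt,
              mul_zero, sub_zero]
            · rw [hm.2]; exact h
            · refine hg.trans_le ?_
              exact_mod_cast h)
        exact ⟨r, q + u, by rw [add_mul, add_right_comm, ← h, sub_add_cancel]⟩
  obtain ⟨r, q, h⟩ := hex ((toPoly g).natDegree + 1) g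
    (Polynomial.degree_le_natDegree.trans_lt (by exact_mod_cast Nat.lt_succ_self _))
  refine ⟨r, ⟨q, h⟩, ?_⟩
  rintro r' ⟨q', h'⟩
  have e : (q - q') * f = toPoly.symm ((r' - r : Polynomial.degreeLT D f.natDegree) : Polynomial D) := by
    have e1 : q * f + toPoly.symm r = q' * f + toPoly.symm (r' : Polynomial D) := by
      rw [← h, ← h']
    rw [sub_mul, Submodule.coe_sub, map_sub, sub_eq_sub_iff_add_eq_add, e1, add_comm]
  have hdeg := Polynomial.mem_degreeLT.mp (r' - r).2
  have e2 : leftMul δ (toPoly (q - q')) (toPoly f)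
      = ((r' - r : Polynomial.degreeLT D f.natDegree) : Polynomial D) := e
  have hq : toPoly (q - q') = 0 := by
    rw [← Polynomial.leadingCoeff_eq_zero, ← coeff_leftMul_top (δ := δ) _ hf, e2]
    refine Polynomial.coeff_eq_zero_of_degree_lt (hdeg.trans_le ?_)
    exact_mod_cast Nat.le_add_right _ _
  rw [hq, map_zero] at e2
  exact sub_eq_zero.mp (Subtype.ext e2.symm)

/-- `g mod_r f`, the remainder of `g` on right division by the monic polynomial `f`. -/
noncomputable def modR {f : DiffPoly δ} (hf : f.Monic) (g : DiffPoly δ) :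
    Polynomial.degreeLT D f.natDegree :=
  (existsUnique_remainder hf g).choose

theorem modR_spec {f : DiffPoly δ} (hf : f.Monic) (g : DiffPoly δ) :
    ∃ q : DiffPoly δ, g = q * f + toPoly.symm (modR hf g) :=
  (existsUnique_remainder hf g).choose_spec.1

theorem modR_eq {f : DiffPoly δ} (hf : f.Monic) {g q : DiffPoly δ} {r : Polynomial.degreeLT D f.natDegree}
    (h : g = q * f + toPoly.symm r) : modR hf g = r :=
  ((existsUnique_remainder hf g).choose_spec.2 r ⟨q, h⟩).symm

theorem modR_add {f : DiffPoly δ} (hf : f.Monic) (g h : DiffPoly δ) :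
    modR hf (g + h) = modR hf g + modR hf h := by
  obtain ⟨q, hq⟩ := modR_spec hf g
  obtain ⟨q', hq'⟩ := modR_spec hf h
  refine modR_eq hf (q := q + q') ?_
  rw [Submodule.coe_add, map_add, add_mul]
  nth_rewrite 1 [hq, hq']
  abel

theorem modR_const_mul {f : DiffPoly δ} (hf : f.Monic) (a : D) (g : DiffPoly δ) :
    modR hf (const δ a * g) = a • modR hf g := by
  obtain ⟨q, hq⟩ := modR_spec hf g
  refine modR_eq hf (q := const δ a * q) ?_
  have e : toPoly.symm ((a • modR hf g : Polynomial.degreeLT D f.natDegree) : Polynomial D)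
      = const δ a * toPoly.symm (modR hf g : Polynomial D) := by
    apply toPoly.injective
    rw [toPoly_const_mul, Submodule.coe_smul, Polynomial.smul_eq_C_mul]
    rfl
  rw [e, mul_assoc, ← mul_add, ← hq]

theorem modR_self {f : DiffPoly δ} (hf : f.Monic) (r : Polynomial.degreeLT D f.natDegree) :
    modR hf (toPoly.symm r) = r := modR_eq hf (q := 0) (by simp)

/-- A central constant is a central element of `D[t;δ]`. -/
theorem const_comm (a : δ.constField) (g : DiffPoly δ) :
    g * const δ ((a : Subring.center D) : D) = const δ ((a : Subring.center D) : D) * g := by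
  have ha : δ ((a : Subring.center D) : D) = 0 := a.2
  have hc := Subring.mem_center_iff.mp (a : Subring.center D).2
  generalize ((a : Subring.center D) : D) = b at ha hc
  have ht : ∀ k, (tMul δ ^ k) (Polynomial.C b) = Polynomial.C b * Polynomial.X ^ k := by
    intro k
    induction k with
    | zero => simp
    | succ k ih =>
      rw [pow_succ']
      change tMul δ ((tMul δ ^ k) (Polynomial.C b)) = _
      rw [ih, tMul_C_mul, ha, ← tMul_pow_one δ k, ← tMul_pow_one δ (k + 1), pow_succ']
      simp
  apply toPoly.injective
  rw [toPoly_const_mul, toPoly_mul]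
  change leftMul δ (toPoly g) (Polynomial.C b) = _
  induction toPoly g using Polynomial.induction_on' with
  | add p₁ p₂ h₁ h₂ => rw [leftMul_add, h₁, h₂, mul_add]
  | monomial i x =>
    rw [leftMul_monomial, ht, ← mul_assoc, ← Polynomial.C_mul, hc,
      Polynomial.C_mul_X_pow_eq_monomial, Polynomial.C_mul_monomial]

end division
end DiffPoly

section petit

open DiffPoly

/-- The Petit algebra `S_f = D[t;δ]/D[t;δ]f` of a monic `f ∈ D[t;δ]` of degree `m`: the
differential polynomials of degree less than `m` with the multiplication
`g ∘ h = gh mod_r f`. -/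
def PetitAlgebra {D : Type*} [DivisionRing D] {δ : RingDerivation D} (f : DiffPoly δ)
    (_hf : f.Monic) : Type _ := Polynomial.degreeLT D f.natDegree

namespace PetitAlgebra

variable {D : Type*} [DivisionRing D] {δ : RingDerivation D} {f : DiffPoly δ} {hf : f.Monic}

noncomputable instance instAddCommGroup : AddCommGroup (PetitAlgebra f hf) :=
  inferInstanceAs (AddCommGroup (Polynomial.degreeLT D f.natDegree))

noncomputable instance instModule : Module D (PetitAlgebra f hf) :=
  inferInstanceAs (Module D (Polynomial.degreeLT D f.natDegree))

/-- The scalar multiplication of `S_f` by the field `F` of central constants: `a • g = a g`. -/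
noncomputable instance instModuleConst : Module δ.constField (PetitAlgebra f hf) :=
  Module.compHom (PetitAlgebra f hf)
    ((Subring.center D).subtype.comp δ.constField.subtype)

/-- The polynomial of degree less than `m` that an element of `S_f` is. -/
noncomputable def lift : PetitAlgebra f hf →+ DiffPoly δ where
  toFun g := toPoly.symm (show Polynomial.degreeLT D f.natDegree from g).1
  map_zero' := rfl
  map_add' _ _ := rfl

/-- `g ↦ g mod_r f`. -/
noncomputable def proj (hf : f.Monic) : DiffPoly δ →+ PetitAlgebra f hf where
  toFun := modR hf
  map_zero' := by
    have h := modR_add hf 0 0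
    rw [add_zero] at h
    exact left_eq_add.mp h
  map_add' := modR_add hf

theorem proj_lift (g : PetitAlgebra f hf) : proj hf (lift g) = g := modR_self hf g

theorem proj_mul_right (p q : DiffPoly δ) : proj hf (p * lift (proj hf q)) = proj hf (p * q) := by
  obtain ⟨u, hu⟩ := modR_spec hf q
  obtain ⟨v, hv⟩ := modR_spec hf (p * lift (proj hf q))
  refine (modR_eq hf (q := p * u + v) ?_).symm
  have hu' : q = u * f + lift (proj hf q) := hu
  nth_rewrite 1 [hu']
  rw [mul_add, add_mul, mul_assoc, add_assoc]
  exact congrArg _ hv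

noncomputable instance instMul : Mul (PetitAlgebra f hf) :=
  ⟨fun g h => proj hf (lift g * lift h)⟩

noncomputable instance instOne : One (PetitAlgebra f hf) := ⟨proj hf 1⟩

theorem mul_def (g h : PetitAlgebra f hf) : g * h = proj hf (lift g * lift h) := rfl

theorem one_def : (1 : PetitAlgebra f hf) = proj hf 1 := rfl

noncomputable instance instNonAssocRing : NonAssocRing (PetitAlgebra f hf) :=
  { instAddCommGroup, instMul, instOne with
    left_distrib := fun a b c => by
      change proj hf (lift a * lift (b + c)) = proj hf (lift a * lift b) + proj hf (lift a * lift c)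
      rw [map_add, mul_add, map_add]
    right_distrib := fun a b c => by
      change proj hf (lift (a + b) * lift c) = proj hf (lift a * lift c) + proj hf (lift b * lift c)
      rw [map_add, add_mul, map_add]
    zero_mul := fun a => by
      change proj hf (lift 0 * lift a) = 0
      rw [map_zero, zero_mul, map_zero]
    mul_zero := fun a => by
      change proj hf (lift a * lift 0) = 0
      rw [map_zero, mul_zero, map_zero]
    mul_one := fun a => by
      change proj hf (lift a * lift (proj hf 1)) = a
      rw [proj_mul_right, mul_one, proj_lift]
    one_mul := fun a => by
      change proj hf (lift (proj hf 1) * lift a) = a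
      rcases Nat.eq_zero_or_pos f.natDegree with h0 | h0
      · have hs : ∀ x : Polynomial.degreeLT D f.natDegree, (x : Polynomial D) = 0 := fun x => by
          have hx := Polynomial.mem_degreeLT.mp x.2
          have hx' : (x : Polynomial D).degree < ((0 : ℕ) : WithBot ℕ) :=
            hx.trans_le (by exact_mod_cast h0.le)
          exact Polynomial.degree_eq_bot.mp (Nat.WithBot.lt_zero_iff.mp hx')
        exact Subtype.ext ((hs _).trans (hs a).symm)
      · have h1 : lift (proj hf (1 : DiffPoly δ)) = 1 := by
          have hm : (1 : Polynomial D) ∈ Polynomial.degreeLT D f.natDegree :=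
            Polynomial.mem_degreeLT.mpr (Polynomial.degree_one_le.trans_lt (by exact_mod_cast h0))
          have hone : (1 : DiffPoly δ) = toPoly.symm 1 := congrArg toPoly.symm Polynomial.C_1
          have := modR_self hf ⟨1, hm⟩
          rw [hone]
          exact congrArg (fun x : Polynomial.degreeLT D f.natDegree => toPoly.symm x.1) this
        rw [h1, one_mul, proj_lift] }

theorem smul_def (a : δ.constField) (g : PetitAlgebra f hf) :
    a • g = proj hf (const δ ((a : Subring.center D) : D) * lift g) := by
  refine Eq.trans ?_ (modR_const_mul hf ((a : Subring.center D) : D) (lift g)).symm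
  exact congrArg (((a : Subring.center D) : D) • ·) (proj_lift g).symm

theorem lift_smul (a : δ.constField) (g : PetitAlgebra f hf) :
    lift (a • g) = const δ ((a : Subring.center D) : D) * lift g := by
  apply toPoly.injective
  rw [toPoly_const_mul, ← Polynomial.smul_eq_C_mul]
  rfl

instance instIsScalarTower :
    IsScalarTower δ.constField (PetitAlgebra f hf) (PetitAlgebra f hf) where
  smul_assoc a x y := by
    rw [smul_eq_mul, smul_eq_mul, smul_def a (x * y), mul_def, mul_def, proj_mul_right, lift_smul,
      mul_assoc]

instance instSMulCommClass :
    SMulCommClass δ.constField (PetitAlgebra f hf) (PetitAlgebra f hf) where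
  smul_comm a x y := by
    rw [smul_eq_mul, smul_eq_mul, smul_def a (x * y), mul_def, mul_def, proj_mul_right, lift_smul,
      ← mul_assoc, ← mul_assoc, const_comm]

end PetitAlgebra

/-- A nonassociative ring `A ≠ 0` is a division algebra if for every `a ≠ 0` the left and right
multiplications by `a` are bijective. -/
def IsNonassocDivision (A : Type*) [NonAssocRing A] : Prop :=
  Nontrivial A ∧ ∀ a : A, a ≠ 0 →
    Function.Bijective (fun x : A => a * x) ∧ Function.Bijective (fun x : A => x * a)

/-- The automorphism group `Aut_F(A)` of a nonassociative `F`-algebra `A`: the ring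
automorphisms of `A` that are `F`-linear. -/
def nonassocAut (F A : Type*) [Field F] [NonAssocRing A] [Module F A] : Subgroup (RingAut A) where
  carrier := {φ | ∀ (a : F) (x : A), φ (a • x) = a • φ x}
  mul_mem' := by
    intro φ ψ hφ hψ a x
    change φ (ψ (a • x)) = a • φ (ψ x)
    rw [hψ, hφ]
  one_mem' := fun _ _ => rfl
  inv_mem' := by
    intro φ hφ a x
    apply φ.injective
    rw [hφ]
    change φ (φ.symm (a • x)) = a • φ (φ.symm x)
    rw [φ.apply_symm_apply, φ.apply_symm_apply]

/-- The polynomial `f = t³ - c t - d ∈ D[t;δ]`. -/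
noncomputable def cubicPoly {D : Type*} [DivisionRing D] (δ : RingDerivation D) (c d : D) :
    DiffPoly δ :=
  t δ ^ 3 - const δ c * t δ - const δ d

theorem cubicPoly_monic {D : Type*} [DivisionRing D] (δ : RingDerivation D) (c d : D) :
    (cubicPoly δ c d).Monic := by
  have h : toPoly (cubicPoly δ c d)
      = Polynomial.X ^ 3 - (Polynomial.C c * Polynomial.X + Polynomial.C d) := by
    rw [cubicPoly, DiffPoly.sub_eq, DiffPoly.sub_eq, toPoly_t_pow, toPoly_const_mul, sub_sub]
    rfl
  change (toPoly (cubicPoly δ c d)).Monic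
  rw [h]
  have hd : (Polynomial.C c * Polynomial.X + Polynomial.C d).degree < ((3 : ℕ) : WithBot ℕ) :=
    Polynomial.degree_linear_le.trans_lt (by exact_mod_cast (by norm_num : 1 < 3))
  exact Polynomial.monic_X_pow_sub hd

/-- The generalized differential algebra `(D, δ, d) = D[t;δ]/D[t;δ]f` with
`f = t³ - c t - d`. -/
abbrev GenDiffAlgebra {D : Type*} [DivisionRing D] (δ : RingDerivation D) (c d : D) : Type _ :=
  PetitAlgebra (cubicPoly δ c d) (cubicPoly_monic δ c d)

end petit

/-! Write `f` for t³ - ct - d and F for the field of central constants. Everything reduces to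
computations with `f` in D[t;δ], which is a domain with additive degrees and right division.

Dimension: the Wronskian of δ(a) and δ(x) is constant because δ³ = cδ on C, so three elements span C
over F (`exists_span_center`). The minimum polynomial has degree 3 and divides the characteristic
polynomial, so [C:F] = 3. Hence [D:F] = 3n², and an element of the algebra is a triple of
coefficients in D.

Division: in finite dimension, being a division algebra means having no zero divisors. A product of
elements vanishes exactly when the product of their lifts is a left multiple of `f`. A right factor
t - z of `f` gives zero divisors at once. Conversely, `not_dvd_of_no_linear_factor` extracts a
linear left or right factor of `f` from any pair of zero divisors. Since c is a central constant,
both left and right division of `f` by t - z leave V₃(z) - cz - d. So one condition governs both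
sides, and the two inequalities of the criterion are the same.

Associativity: in characteristic 3, [f, a] = δ³(a) - cδ(a) + [a, d] for constants a, and [f, t] =
δ(d). If δ³ = cδ, these vanish exactly when d is a central constant. Then `f` is central and the
algebra is a quotient ring. Conversely, associativity forces fz to be a left multiple of `f` for all
z (`proj_mul_eq_zero_of_assoc`).

Automorphisms: for a central unit u, δ³(u) = cδ(u) makes `f` commute with u whatever d is, so x ↦
u⁻¹xu descends to the algebra. It sends t to t + δ(u)/u and is trivial exactly when δ(u) = 0. Thus
C^×/F^× embeds in the automorphism group, and the logarithmic derivative identifies this quotient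
with the group of the δ(u)/u. -/

namespace DiffPoly

variable {D : Type*}

/-! ### Degrees and leading terms of products. -/

section degree

variable [Ring D] {δ : RingDerivation D}

/-- The term δ(b)tʲ in t·btʲ never reaches the top degree, so t merely shifts the top coefficient.
Working with a bound `n` instead of the exact degree allows that coefficient to be zero. -/
theorem natDegree_tMul_pow_le {n : ℕ} {q : Polynomial D} (hq : q.natDegree ≤ n) (i : ℕ) :
    ((tMul δ ^ i) q).natDegree ≤ n + i ∧ ((tMul δ ^ i) q).coeff (n + i) = q.coeff n := by
  induction i with
  | zero => exact ⟨hq, rfl⟩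
  | succ i ih =>
    rw [pow_succ']
    change (tMul δ ((tMul δ ^ i) q)).natDegree ≤ _ ∧ (tMul δ ((tMul δ ^ i) q)).coeff _ = _
    generalize (tMul δ ^ i) q = g at ih
    obtain ⟨h1, h2⟩ := ih
    have hz : ∀ k, n + i < k → g.coeff k = 0 := fun k hk =>
      Polynomial.coeff_eq_zero_of_natDegree_lt (by omega)
    constructor
    · rw [Polynomial.natDegree_le_iff_coeff_eq_zero]
      intro k hk
      obtain ⟨k, rfl⟩ : ∃ j, k = j + 1 := ⟨k - 1, by omega⟩
      rw [coeff_tMul_succ, hz k (by omega), hz (k + 1) (by omega), map_zero, add_zero]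
    · rw [← add_assoc, coeff_tMul_succ, h2, hz _ (Nat.lt_succ_self _), map_zero, add_zero]

/-- Only the summand of index `m` reaches degree `m + n`. Over a division ring the product of
leading coefficients is nonzero, which makes D[t;δ] a domain with additive degrees. -/
theorem natDegree_leftMul_le {m n : ℕ} {p q : Polynomial D} (hp : p.natDegree ≤ m)
    (hq : q.natDegree ≤ n) : (leftMul δ p q).natDegree ≤ m + n ∧
      (leftMul δ p q).coeff (m + n) = p.coeff m * q.coeff n := by
  have e : leftMul δ p q = ∑ i ∈ Finset.range (m + 1),
      Polynomial.C (p.coeff i) * (tMul δ ^ i) q := by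
    conv_lhs => rw [p.as_sum_range' (m + 1) (by omega), map_sum]
    refine (AddMonoidHom.finsetSum_apply _ _ _).trans ?_
    exact Finset.sum_congr rfl fun i _ => leftMul_monomial δ _ _ _
  have hi : ∀ i, ((tMul δ ^ i) q).natDegree ≤ n + i := fun i => (natDegree_tMul_pow_le hq i).1
  rw [e]
  constructor
  · rw [Polynomial.natDegree_le_iff_coeff_eq_zero]
    intro k hk
    rw [Polynomial.finsetSum_coeff]
    refine Finset.sum_eq_zero fun i him => ?_
    have := Finset.mem_range.mp him
    have hz : ((tMul δ ^ i) q).coeff k = 0 :=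
      Polynomial.coeff_eq_zero_of_natDegree_lt ((hi i).trans_lt (by omega))
    rw [Polynomial.coeff_C_mul, hz, mul_zero]
  · rw [Polynomial.finsetSum_coeff, Finset.sum_range_succ, Finset.sum_eq_zero, zero_add,
      Polynomial.coeff_C_mul, add_comm, (natDegree_tMul_pow_le hq m).2]
    intro i him
    have := Finset.mem_range.mp him
    have hz : ((tMul δ ^ i) q).coeff (m + n) = 0 :=
      Polynomial.coeff_eq_zero_of_natDegree_lt ((hi i).trans_lt (by omega))
    rw [Polynomial.coeff_C_mul, hz, mul_zero]

theorem const_one : const δ 1 = 1 := rfl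

theorem const_zero : const δ 0 = 0 := toPoly.injective Polynomial.C_0

theorem toPoly_const (a : D) : toPoly (const δ a) = Polynomial.C a := rfl

theorem toPoly_t : toPoly (t δ) = Polynomial.X := rfl

end degree

/-! ### Factorization in D[t;δ] over a division ring. -/

section domain

variable [DivisionRing D] {δ : RingDerivation D}

theorem natDegree_mul_le (p q : DiffPoly δ) : (p * q).natDegree ≤ p.natDegree + q.natDegree :=
  (natDegree_leftMul_le le_rfl le_rfl).1

theorem natDegree_mul {p q : DiffPoly δ} (hp : p ≠ 0) (hq : q ≠ 0) :
    p * q ≠ 0 ∧ (p * q).natDegree = p.natDegree + q.natDegree := by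
  have h := natDegree_leftMul_le (δ := δ) (p := toPoly p) (q := toPoly q) le_rfl le_rfl
  have h0 : (toPoly (p * q)).coeff (p.natDegree + q.natDegree) ≠ 0 := by
    refine h.2.trans_ne (mul_ne_zero ?_ ?_)
    · exact Polynomial.leadingCoeff_ne_zero.mpr fun e => hp (toPoly.injective e)
    · exact Polynomial.leadingCoeff_ne_zero.mpr fun e => hq (toPoly.injective e)
  refine ⟨?_, le_antisymm h.1 (Polynomial.le_natDegree_of_ne_zero h0)⟩
  intro e
  rw [e] at h0
  exact h0 rfl

theorem natDegree_const (a : D) : (const δ a).natDegree = 0 := Polynomial.natDegree_C a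

theorem Monic.ne_zero {f : DiffPoly δ} (hf : f.Monic) : f ≠ 0 := fun e =>
  Polynomial.Monic.ne_zero hf (congrArg toPoly e)

theorem t_sub_const_ne_zero (z : D) : t δ - const δ z ≠ 0 := fun e =>
  Polynomial.X_sub_C_ne_zero z (congrArg toPoly e)

/-- An element that commutes with `t` and all constants is central. -/
theorem forall_comm_of_comm_const_of_comm_t {f : DiffPoly δ}
    (hC : ∀ a, f * const δ a = const δ a * f) (ht : f * t δ = t δ * f) (p : DiffPoly δ) :
    f * p = p * f := by
  obtain ⟨p, rfl⟩ := toPoly.symm.surjective p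
  induction p using Polynomial.induction_on' with
  | add p₁ p₂ h₁ h₂ => rw [map_add, mul_add, add_mul, h₁, h₂]
  | monomial i a =>
    have e : toPoly.symm (Polynomial.monomial i a) = const δ a * t δ ^ i := by
      apply toPoly.injective
      rw [toPoly_const_mul, toPoly_t_pow, Polynomial.C_mul_X_pow_eq_monomial]
      rfl
    have hi : Commute f (t δ ^ i) := Commute.pow_right ht i
    rw [e, ← mul_assoc, hC, mul_assoc, hi.eq, mul_assoc]

theorem natDegree_cubicPoly (c d : D) : (cubicPoly δ c d).natDegree = 3 := by
  have h : toPoly (cubicPoly δ c d)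
      = Polynomial.X ^ 3 - (Polynomial.C c * Polynomial.X + Polynomial.C d) := by
    rw [cubicPoly, DiffPoly.sub_eq, DiffPoly.sub_eq, toPoly_t_pow, toPoly_const_mul, sub_sub]
    rfl
  change (toPoly (cubicPoly δ c d)).natDegree = 3
  rw [h, Polynomial.natDegree_sub_eq_left_of_natDegree_lt, Polynomial.natDegree_X_pow]
  rw [Polynomial.natDegree_X_pow]
  exact Polynomial.natDegree_linear_le.trans_lt (by norm_num)

/-- Every nonzero polynomial is a constant times a monic one. -/
theorem exists_const_mul_monic {h : DiffPoly δ} (h0 : h ≠ 0) :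
    ∃ (a : D) (k : DiffPoly δ), a ≠ 0 ∧ k.Monic ∧ h = const δ a * k := by
  have h0' : toPoly h ≠ 0 := fun e => h0 (toPoly.injective e)
  have hl := Polynomial.leadingCoeff_ne_zero.mpr h0'
  refine ⟨(toPoly h).leadingCoeff,
    toPoly.symm (Polynomial.C (toPoly h).leadingCoeff⁻¹ * toPoly h), hl, ?_, ?_⟩
  · change (Polynomial.C (toPoly h).leadingCoeff⁻¹ * toPoly h).Monic
    rw [Polynomial.Monic, Polynomial.leadingCoeff_mul, Polynomial.leadingCoeff_C,
      inv_mul_cancel₀ hl]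
  · apply toPoly.injective
    rw [toPoly_const_mul, AddEquiv.apply_symm_apply, ← mul_assoc, ← Polynomial.C_mul,
      mul_inv_cancel₀ hl, Polynomial.C_1, one_mul]

/-- A monic polynomial of degree 1 is `t - z`. -/
theorem Monic.eq_t_sub_const {h : DiffPoly δ} (hm : h.Monic) (h1 : h.natDegree = 1) :
    ∃ z, h = t δ - const δ z := by
  refine ⟨-(toPoly h).coeff 0, toPoly.injective ?_⟩
  rw [sub_eq, toPoly_const, toPoly_t, Polynomial.C_neg, sub_neg_eq_add]
  exact Polynomial.Monic.eq_X_add_C hm h1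

/-- A monic polynomial of degree 0 is 1. -/
theorem Monic.eq_one {h : DiffPoly δ} (hm : h.Monic) (h0 : h.natDegree = 0) : h = 1 :=
  toPoly.injective (Polynomial.Monic.natDegree_eq_zero hm |>.mp h0)

theorem exists_quotient {h : DiffPoly δ} (hh : h.Monic) (f : DiffPoly δ) :
    ∃ l r : DiffPoly δ, f = l * h + r ∧ (r = 0 ∨ r.natDegree < h.natDegree) := by
  obtain ⟨l, hl⟩ := modR_spec hh f
  refine ⟨l, _, hl, ?_⟩
  by_cases h0 : (modR hh f : Polynomial D) = 0
  · left; rw [h0]; rfl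
  · right
    exact (Polynomial.natDegree_lt_iff_degree_lt h0).mpr
      (Polynomial.mem_degreeLT.mp (modR hh f).2)

theorem const_mul_cancel {a : D} (ha : a ≠ 0) (g : DiffPoly δ) :
    const δ a⁻¹ * (const δ a * g) = g := by
  rw [← mul_assoc, const_mul_const, inv_mul_cancel₀ ha, const_one, one_mul]

/-- Moving a nonzero constant through a linear factor. -/
theorem t_sub_const_mul_const {a : D} (ha : a ≠ 0) (z : D) :
    ∃ z', const δ a * (t δ - const δ z) = (t δ - const δ z') * const δ a := by
  -- From at = ta - δ(a), one gets a(t - z) = ta - (az + δ(a)); the factor a is then taken out on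
  -- the right.
  refine ⟨(a * z + δ a) * a⁻¹, ?_⟩
  rw [sub_mul, mul_sub, t_mul_const, const_mul_const, const_mul_const, inv_mul_cancel_right₀ ha,
    const_add]
  abel

/-- If a cubic `f` has no linear right factor and no linear left factor, then a product of two
nonzero polynomials of degree less than 3 is not a left multiple of `f`. -/
theorem not_dvd_of_no_linear_factor {f : DiffPoly δ} (hf : f ≠ 0) (hf3 : f.natDegree = 3)
    (hr : ∀ z g, f ≠ g * (t δ - const δ z)) (hl : ∀ z g, f ≠ (t δ - const δ z) * g)
    {g h q : DiffPoly δ} (hg : g ≠ 0) (hh : h ≠ 0) (hg3 : g.natDegree < 3)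
    (hh3 : h.natDegree < 3) : g * h ≠ q * f := by
  -- Factors need not be monic. The leading coefficient of a right factor is absorbed into the
  -- cofactor; that of a left factor must first be moved through t - z, which changes z.
  have hr' : ∀ r g : DiffPoly δ, r ≠ 0 → r.natDegree = 1 → f ≠ g * r := by
    intro r g hr0 hr1 e
    obtain ⟨a, k, ha, hk, rfl⟩ := exists_const_mul_monic hr0
    rw [(natDegree_mul (left_ne_zero_of_mul hr0) hk.ne_zero).2, natDegree_const, zero_add] at hr1
    obtain ⟨z, rfl⟩ := hk.eq_t_sub_const hr1
    exact hr z (g * const δ a) (by rw [e, mul_assoc])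
  have hl' : ∀ l g : DiffPoly δ, l ≠ 0 → l.natDegree = 1 → f ≠ l * g := by
    intro l g hl0 hl1 e
    obtain ⟨a, k, ha, hk, rfl⟩ := exists_const_mul_monic hl0
    rw [(natDegree_mul (left_ne_zero_of_mul hl0) hk.ne_zero).2, natDegree_const, zero_add] at hl1
    obtain ⟨z, rfl⟩ := hk.eq_t_sub_const hl1
    obtain ⟨z', hz'⟩ := t_sub_const_mul_const (δ := δ) ha z
    exact hl z' (const δ a * g) (by rw [e, hz', mul_assoc])
  intro e
  have hq : q ≠ 0 := by
    rintro rfl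
    rw [zero_mul] at e
    exact (natDegree_mul hg hh).1 e
  have hdeg := congrArg natDegree e
  rw [(natDegree_mul hg hh).2, (natDegree_mul hq hf).2, hf3] at hdeg
  have hconst : q.natDegree = 0 → ∃ b, f = const δ b * (g * h) := by
    intro hq0
    obtain ⟨a, k, ha, hk, rfl⟩ := exists_const_mul_monic hq
    rw [(natDegree_mul (left_ne_zero_of_mul hq) hk.ne_zero).2, natDegree_const, zero_add] at hq0
    rw [hk.eq_one hq0, mul_one] at e
    exact ⟨a⁻¹, by rw [e, const_mul_cancel ha]⟩
  -- Degrees give deg g + deg h = deg q + 3 ≤ 4. If q is constant, `f` is a constant times gh and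
  -- one of g, h is linear; otherwise deg q = 1 and deg g = deg h = 2.
  rcases Nat.eq_zero_or_pos q.natDegree with hq0 | hq0
  · obtain ⟨b, hb⟩ := hconst hq0
    have hb0 : const δ b ≠ 0 := by
      intro h0
      rw [h0, zero_mul] at hb
      exact hf hb
    rcases (by omega : h.natDegree = 1 ∨ g.natDegree = 1) with h1 | h1
    · exact hr' h (const δ b * g) hh h1 (by rw [hb, mul_assoc])
    · refine hl' (const δ b * g) h (natDegree_mul hb0 hg).1 ?_ (by rw [hb, mul_assoc])
      rw [(natDegree_mul hb0 hg).2, natDegree_const, h1]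
  · have hq1 : q.natDegree = 1 := by omega
    have hh2 : h.natDegree = 2 := by omega
    obtain ⟨a, k, ha, hk, hak⟩ := exists_const_mul_monic hh
    have ha0 : const δ a ≠ 0 := by
      intro h0
      rw [h0, zero_mul] at hak
      exact hh hak
    have hk2 : k.natDegree = 2 := by
      rw [← hh2, hak, (natDegree_mul ha0 hk.ne_zero).2, natDegree_const, zero_add]
    obtain ⟨l, r, hlr, hr0⟩ := exists_quotient hk f
    have hl0 : l ≠ 0 := by
      rintro rfl
      rw [zero_mul, zero_add] at hlr
      rw [hlr] at hf hf3
      rcases hr0 with h0 | h0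
      · exact hf h0
      · omega
    by_cases h0 : r = 0
    · rw [h0, add_zero] at hlr
      refine hl' l k hl0 ?_ hlr
      have := (natDegree_mul hl0 hk.ne_zero).2
      rw [← hlr] at this
      omega
    -- Substituting f = lk + r into gh = qf, with h = ak. The right side has degree at most 2 = deg
    -- k, so the cofactor of k is a nonzero constant b and r is linear.
    have key : (g * const δ a - q * l) * k = q * r := by
      rw [sub_mul, mul_assoc, ← hak, e, hlr]
      noncomm_ring
    have hqr := natDegree_mul hq h0
    have hs0 : g * const δ a - q * l ≠ 0 := by
      intro h
      rw [h, zero_mul] at key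
      exact hqr.1 key.symm
    have hd := congrArg natDegree key
    rw [(natDegree_mul hs0 hk.ne_zero).2, hqr.2] at hd
    have hr1 := hr0.resolve_left h0
    obtain ⟨b, m, hb, hm, hbm⟩ := exists_const_mul_monic hs0
    have hb0 : const δ b ≠ 0 := by
      intro h
      rw [h, zero_mul] at hbm
      exact hs0 hbm
    have hmd : m.natDegree = 0 := by
      have := (natDegree_mul hb0 hm.ne_zero).2
      rw [← hbm, natDegree_const] at this
      omega
    rw [hbm, hm.eq_one hmd, mul_one] at key
    have hk' : k = const δ b⁻¹ * (q * r) := by rw [← key, const_mul_cancel hb]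
    -- Now k = b⁻¹qr is itself a left multiple of r, hence so is f = lk + r.
    refine hr' r (l * (const δ b⁻¹ * q) + 1) h0 (by omega) ?_
    nth_rewrite 1 [hlr, hk']
    noncomm_ring

end domain

/-! ### Commutators and linear remainders of t³ - ct - d. -/

section cubic

variable [DivisionRing D] {δ : RingDerivation D}

/-- The Leibniz expansion of t³a has binomial coefficients 1, 3, 3, 1, and the middle two vanish in
characteristic 3. -/
theorem t_pow_three_mul_const [CharP D 3] (a : D) :
    t δ ^ 3 * const δ a = const δ a * t δ ^ 3 + const δ (δ (δ (δ a))) := by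
  have h3 : ∀ x : D, x + x + x = 0 := fun x => by
    have h : ((3 : ℕ) : D) = 0 := CharP.cast_eq_zero D 3
    have e : x + x + x = ((3 : ℕ) : D) * x := by push_cast; noncomm_ring
    rw [e, h, zero_mul]
  have k1 : ∀ b : D, const δ b + const δ b + const δ b = 0 := fun b => by
    rw [← const_add, ← const_add, h3, const_zero]
  have r := t_mul_const δ
  have e : t δ ^ 3 * const δ a = const δ a * t δ ^ 3
      + (const δ (δ a) + const δ (δ a) + const δ (δ a)) * t δ ^ 2
      + (const δ (δ (δ a)) + const δ (δ (δ a)) + const δ (δ (δ a))) * t δ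
      + const δ (δ (δ (δ a))) := by
    simp only [pow_succ, pow_zero, one_mul, mul_assoc, r, mul_add, add_mul]
    simp only [← mul_assoc, r, mul_add, add_mul]
    simp only [mul_assoc]
    abel
  rw [e, k1, k1, zero_mul, zero_mul, add_zero, add_zero]

theorem coe_constField_comm (c : δ.constField) (x : D) :
    ((c : Subring.center D) : D) * x = x * ((c : Subring.center D) : D) :=
  (Subring.mem_center_iff.mp (c : Subring.center D).2 x).symm

/-- The commutator has degree 0: it is g(δ)(a) + [a, d]. Its vanishing decides both associativity
and which conjugations descend to the algebra. -/
theorem cubicPoly_mul_const [CharP D 3] (c : δ.constField) (d a : D) :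
    cubicPoly δ c d * const δ a = const δ a * cubicPoly δ c d
      + const δ (δ (δ (δ a)) - c * δ a + (a * d - d * a)) := by
  simp only [cubicPoly, sub_mul, mul_sub, t_pow_three_mul_const, mul_assoc, t_mul_const, mul_add,
    const_sub, const_add, ← const_mul_const]
  rw [← mul_assoc (const δ (c : D)), const_mul_const, coe_constField_comm, ← const_mul_const,
    mul_assoc]
  abel

/-- Since c is a central constant, t commutes with t³ - ct, and only the commutator of t with d
remains. -/
theorem cubicPoly_mul_t (c : δ.constField) (d : D) :
    cubicPoly δ c d * t δ = t δ * cubicPoly δ c d + const δ (δ d) := by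
  have h := const_comm c (t δ)
  rw [cubicPoly, sub_mul, sub_mul, mul_sub, mul_sub, t_mul_const, ← mul_assoc (t δ), h]
  noncomm_ring

/-- The remainder of `t³ - c t - d` on right division by `t - z`. -/
theorem cubicPoly_eq_mul_t_sub [CharP D 3] (c d z : D) :
    cubicPoly δ c d = ((t δ - const δ z) ^ 2 - const δ c) * (t δ - const δ z)
      + const δ (V δ 3 z - c * z - d) := by
  have h := t_sub_const_pow_three δ z
  rw [← V_three] at h
  rw [sub_mul, ← pow_succ, h, cubicPoly, const_sub, const_sub, mul_sub, const_mul_const]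
  abel

/-- The remainder of `t³ - c t - d` on left division by `t - z`. -/
theorem cubicPoly_eq_t_sub_mul [CharP D 3] (c : δ.constField) (d z : D) :
    cubicPoly δ c d = (t δ - const δ z) * ((t δ - const δ z) ^ 2 - const δ c)
      + const δ (V δ 3 z - c * z - d) := by
  have h := t_sub_const_pow_three δ z
  rw [← V_three] at h
  have hc : δ (c : D) = 0 := c.2
  rw [mul_sub, ← pow_succ', h, cubicPoly, const_sub, const_sub, sub_mul, const_mul_const,
    t_mul_const, hc, const_zero, coe_constField_comm]
  abel

end cubic

end DiffPoly

/-! ### The degree of the centre over the central constants. -/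

namespace RingDerivation

variable {D : Type*} [DivisionRing D] {δ : RingDerivation D}

theorem onCenter_mul (x y : Subring.center D) :
    δ.onCenter (x * y) = x * δ.onCenter y + δ.onCenter x * y :=
  Subtype.ext (δ.leibniz x y)

theorem mem_constField {x : Subring.center D} : x ∈ δ.constField ↔ δ.onCenter x = 0 :=
  (Subtype.ext_iff (a1 := δ.onCenter x) (a2 := 0)).symm

/-- If `y ≠ 0` and the Wronskian of `y` and `v` vanishes, then `v / y` is constant. -/
theorem div_mem_constField {y v : Subring.center D} (hy : y ≠ 0)
    (h : y * δ.onCenter v - v * δ.onCenter y = 0) : v / y ∈ δ.constField := by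
  have e := onCenter_mul (δ := δ) y (v / y)
  rw [mul_div_cancel₀ v hy] at e
  rw [mem_constField]
  have h2 : y * (y * δ.onCenter (v / y)) = 0 := by
    have h3 : v / y * y = v := div_mul_cancel₀ v hy
    linear_combination (-y) * e + h - δ.onCenter y * h3
  simpa [hy] using h2

/-- A field with a derivation `δ` with `δ³ = cδ` is spanned by three elements over its field of
constants. -/
theorem exists_span_center (c : δ.constField)
    (h3 : ∀ x, δ.onCenter (δ.onCenter (δ.onCenter x)) = c * δ.onCenter x) :
    ∃ s : Finset (Subring.center D), s.card ≤ 3 ∧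
      Submodule.span δ.constField (s : Set (Subring.center D)) = ⊤ := by
  classical
  by_cases ha : ∃ a, δ.onCenter a ≠ 0
  · obtain ⟨a, ha⟩ := ha
    -- The Wronskian of δ(a) and δ(x). Its derivative is δ(a)δ³(x) - δ(x)δ³(a), which is zero
    -- because δ³ = cδ.
    let W : Subring.center D → Subring.center D := fun x =>
      δ.onCenter a * δ.onCenter (δ.onCenter x) - δ.onCenter x * δ.onCenter (δ.onCenter a)
    have hW : ∀ x, δ.onCenter (W x) = 0 := fun x => by
      simp only [W, map_sub, onCenter_mul, h3]
      ring
    -- All values of W lie in F, so any nonzero value spans them; if W vanishes identically, b = 0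
    -- serves.
    obtain ⟨b, hb⟩ : ∃ b, ∀ x, ∃ m : δ.constField, W x = m * W b := by
      by_cases hb : ∃ b, W b ≠ 0
      · obtain ⟨b, hb⟩ := hb
        refine ⟨b, fun x => ⟨⟨W x / W b, ?_⟩, (div_mul_cancel₀ _ hb).symm⟩⟩
        exact div_mem (mem_constField.mpr (hW x)) (mem_constField.mpr (hW b))
      · push Not at hb
        exact ⟨0, fun x => ⟨0, by rw [hb, hb, mul_zero]⟩⟩
    refine ⟨{1, a, b}, Finset.card_le_three, ?_⟩
    rw [eq_top_iff]
    rintro x -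
    obtain ⟨m, hm⟩ := hb x
    have hz : W (x - m • b) = 0 := by
      have hs : ∀ y, δ.onCenter (m • y) = m * δ.onCenter y := fun y => map_smul δ.onCenter m y
      have hs' : δ.onCenter (m * δ.onCenter b) = m * δ.onCenter (δ.onCenter b) := hs _
      simp only [W, map_sub, hs, hs'] at hm ⊢
      linear_combination hm
    -- Subtracting mb has killed the Wronskian, so δ(x - mb) is a constant multiple of δ(a), and x -
    -- mb - la is itself constant.
    let l : δ.constField := ⟨_, div_mem_constField ha hz⟩
    have hl : δ.onCenter (x - m • b) = l * δ.onCenter a := (div_mul_cancel₀ _ ha).symm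
    have hn : x - m • b - l • a ∈ δ.constField := by
      rw [mem_constField, map_sub, hl, map_smul, Subfield.smul_def, smul_eq_mul, sub_self]
    have hx : x = (⟨_, hn⟩ : δ.constField) • (1 : Subring.center D) + l • a + m • b := by
      rw [Subfield.smul_def (⟨_, hn⟩ : δ.constField), smul_eq_mul, mul_one,
        sub_add_cancel, sub_add_cancel]
    rw [hx]
    refine add_mem (add_mem ?_ ?_) ?_ <;>
      refine Submodule.smul_mem _ _ (Submodule.subset_span ?_) <;> simp
  · push Not at ha
    refine ⟨{1}, by simp, ?_⟩
    rw [eq_top_iff]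
    rintro x -
    have hx : x = (⟨x, mem_constField.mpr (ha x)⟩ : δ.constField) • (1 : Subring.center D) := by
      rw [Subfield.smul_def, smul_eq_mul, mul_one]
    rw [hx]
    exact Submodule.smul_mem _ _ (Submodule.subset_span (by simp))

open Polynomial in
theorem onCenter_pow_three {c : δ.constField}
    (hδ : minpoly δ.constField (δ.onCenter : Module.End δ.constField (Subring.center D))
      = X ^ 3 - C c * X) (x : Subring.center D) :
    δ.onCenter (δ.onCenter (δ.onCenter x)) = c * δ.onCenter x := by
  have h := minpoly.aeval δ.constField
    (δ.onCenter : Module.End δ.constField (Subring.center D))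
  rw [hδ] at h
  have h' := LinearMap.congr_fun h x
  simp only [map_sub, map_pow, map_mul, aeval_X, aeval_C] at h'
  exact sub_eq_zero.mp h'

open Polynomial in
-- The span by three elements gives the upper bound; the lower one holds because the minimum
-- polynomial, of degree 3, divides the characteristic polynomial, whose degree is the dimension.
theorem finrank_center {c : δ.constField}
    (hδ : minpoly δ.constField (δ.onCenter : Module.End δ.constField (Subring.center D))
      = X ^ 3 - C c * X) :
    Module.finrank δ.constField (Subring.center D) = 3 := by
  obtain ⟨s, hs, htop⟩ := exists_span_center c (onCenter_pow_three hδ)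
  have : FiniteDimensional δ.constField (Subring.center D) :=
    Module.finite_def.mpr ⟨s, htop⟩
  refine le_antisymm ?_ ?_
  · have h := finrank_span_finset_le_card (R := δ.constField) s
    rw [Set.finrank, htop, finrank_top] at h
    exact h.trans hs
  · let T : Module.End δ.constField (Subring.center D) := δ.onCenter
    have h := Polynomial.natDegree_le_of_dvd (LinearMap.minpoly_dvd_charpoly T)
      (LinearMap.charpoly_monic T).ne_zero
    rw [LinearMap.charpoly_natDegree, hδ] at h
    refine le_trans (le_of_eq ?_) h
    rw [natDegree_sub_eq_left_of_natDegree_lt, natDegree_X_pow]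
    rw [natDegree_X_pow]
    exact (natDegree_C_mul_le c X |>.trans natDegree_X_le).trans_lt (by norm_num)

end RingDerivation

/-! ### The dimension of a Petit algebra. -/

namespace PetitAlgebra

open DiffPoly

variable {D : Type*} [DivisionRing D] {δ : RingDerivation D} {f : DiffPoly δ} {hf : f.Monic}

/-- The coefficients of an element of a Petit algebra. -/
noncomputable def coeffEquiv (hf : f.Monic) :
    PetitAlgebra f hf ≃ₗ[δ.constField] (Fin f.natDegree → D) :=
  { (Polynomial.degreeLTEquiv D f.natDegree) with
    map_smul' := fun a x =>
      (Polynomial.degreeLTEquiv D f.natDegree).map_smul ((a : Subring.center D) : D) x }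

theorem finrank_eq [FiniteDimensional δ.constField D] :
    Module.finrank δ.constField (PetitAlgebra f hf)
      = f.natDegree * Module.finrank δ.constField D := by
  rw [(coeffEquiv hf).finrank_eq, Module.finrank_pi_fintype]
  simp

instance [FiniteDimensional δ.constField D] :
    FiniteDimensional δ.constField (PetitAlgebra f hf) :=
  Module.Finite.equiv (coeffEquiv hf).symm

end PetitAlgebra

/-! ### Zero divisors, associativity and conjugations in Petit algebras. -/

namespace PetitAlgebra

open DiffPoly

variable {D : Type*} [DivisionRing D] {δ : RingDerivation D} {f : DiffPoly δ} {hf : f.Monic}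

theorem proj_eq_zero_iff {p : DiffPoly δ} : proj hf p = 0 ↔ ∃ q, p = q * f := by
  constructor
  · intro h
    obtain ⟨q, hq⟩ := modR_spec hf p
    have h0 : modR hf p = 0 := h
    rw [h0] at hq
    exact ⟨q, hq.trans (add_zero _)⟩
  · rintro ⟨q, rfl⟩
    exact modR_eq hf (q := q) (add_zero _).symm

theorem lift_injective : Function.Injective (lift : PetitAlgebra f hf →+ DiffPoly δ) :=
  Function.LeftInverse.injective proj_lift

theorem lift_ne_zero {x : PetitAlgebra f hf} (hx : x ≠ 0) : lift x ≠ 0 := fun h =>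
  hx (lift_injective (h.trans (map_zero lift).symm))

theorem natDegree_lift_lt (hf0 : 0 < f.natDegree) (x : PetitAlgebra f hf) :
    (lift x).natDegree < f.natDegree := by
  by_cases hx : toPoly (lift x) = 0
  · rw [DiffPoly.natDegree, hx, Polynomial.natDegree_zero]
    exact hf0
  · exact (Polynomial.natDegree_lt_iff_degree_lt hx).mpr (Polynomial.mem_degreeLT.mp
      (show Polynomial.degreeLT D f.natDegree from x).2)

theorem lift_proj {p : DiffPoly δ} (hp : p.natDegree < f.natDegree) : lift (proj hf p) = p := by
  have hm : toPoly p ∈ Polynomial.degreeLT D f.natDegree :=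
    Polynomial.mem_degreeLT.mpr (Polynomial.degree_le_natDegree.trans_lt (by exact_mod_cast hp))
  exact congrArg (fun x : Polynomial.degreeLT D f.natDegree => toPoly.symm x.1)
    (modR_self hf ⟨_, hm⟩)

/-- Left and right multiplications are F-linear endomorphisms of a finite-dimensional space, so
injective ones are bijective. Positive degree of `f` ensures 1 ≠ 0. -/
theorem isNonassocDivision_iff [FiniteDimensional δ.constField D] (hf0 : 0 < f.natDegree) :
    IsNonassocDivision (PetitAlgebra f hf) ↔
      ∀ x y : PetitAlgebra f hf, x ≠ 0 → y ≠ 0 → x * y ≠ 0 := by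
  constructor
  · rintro ⟨-, h⟩ x y hx hy hxy
    exact hy ((h x hx).1.1 (hxy.trans (mul_zero x).symm))
  · intro h
    refine ⟨⟨1, 0, fun e => ?_⟩, fun a ha => ⟨?_, ?_⟩⟩
    · have h1 : lift (proj hf 1) = 1 := lift_proj (by rwa [← const_one, natDegree_const])
      rw [← one_def, e, map_zero] at h1
      exact one_ne_zero (Polynomial.C_injective ((congrArg toPoly h1).symm.trans
        Polynomial.C_0.symm))
    · let L : PetitAlgebra f hf →ₗ[δ.constField] PetitAlgebra f hf :=
        { toFun := fun x => a * x
          map_add' := mul_add a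
          map_smul' := fun r x => (instSMulCommClass.smul_comm r a x).symm }
      have hi : Function.Injective L := by
        rw [injective_iff_map_eq_zero]
        intro x hx
        by_contra hx0
        exact h a x ha hx0 hx
      exact ⟨hi, LinearMap.injective_iff_surjective.mp hi⟩
    · let R : PetitAlgebra f hf →ₗ[δ.constField] PetitAlgebra f hf :=
        { toFun := fun x => x * a
          map_add' := fun x y => add_mul x y a
          map_smul' := fun r x => instIsScalarTower.smul_assoc r x a }
      have hi : Function.Injective R := by
        rw [injective_iff_map_eq_zero]
        intro x hx
        by_contra hx0
        exact h x a hx0 ha hx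
      exact ⟨hi, LinearMap.injective_iff_surjective.mp hi⟩

/-- For central `f` the left ideal it generates is two-sided, so the algebra is a quotient ring.
Concretely, if xy = qf + r, the associator is the class of -qfz = -(qz)f. -/
theorem mul_assoc_of_forall_comm (h : ∀ p, f * p = p * f) (x y z : PetitAlgebra f hf) :
    x * y * z = x * (y * z) := by
  rw [mul_def x (y * z), mul_def y z, proj_mul_right, mul_def (x * y) z, mul_def x y]
  obtain ⟨q, hq⟩ := modR_spec hf (lift x * lift y)
  have hq' : lift x * lift y = q * f + lift (proj hf (lift x * lift y)) := hq
  rw [← mul_assoc, ← sub_eq_zero, ← map_sub, ← sub_mul, proj_eq_zero_iff]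
  refine ⟨-(q * lift z), ?_⟩
  nth_rewrite 2 [hq']
  rw [sub_add_cancel_right, neg_mul, neg_mul, mul_assoc, mul_assoc, h]

/-- If a Petit algebra of degree at least 2 is associative, `f z` is a left multiple of `f` for
every `z`. -/
theorem proj_mul_eq_zero_of_assoc (hf2 : 2 ≤ f.natDegree)
    (h : ∀ x y z : PetitAlgebra f hf, x * y * z = x * (y * z)) (z : DiffPoly δ) :
    proj hf (f * z) = 0 := by
  have hk : ∀ k, (t δ ^ k).natDegree = k := fun k => by
    rw [DiffPoly.natDegree, toPoly_t_pow, Polynomial.natDegree_X_pow]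
  have hs : ∃ s, s.natDegree < f.natDegree ∧ f = t δ ^ (f.natDegree - 1) * t δ + s := by
    refine ⟨f - t δ ^ f.natDegree, ?_, ?_⟩
    · have hd : (toPoly (f - t δ ^ f.natDegree)).degree < f.natDegree := by
        rw [sub_eq, toPoly_t_pow]
        have h0 : (toPoly f).degree = f.natDegree :=
          Polynomial.degree_eq_natDegree (Polynomial.Monic.ne_zero hf)
        rw [← h0]
        refine Polynomial.degree_sub_lt_left ?_ (Polynomial.Monic.ne_zero hf) ?_
        · rw [Polynomial.degree_X_pow, h0]
        · rw [(show (toPoly f).Monic from hf).leadingCoeff, Polynomial.leadingCoeff_X_pow]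
      by_cases h0 : toPoly (f - t δ ^ f.natDegree) = 0
      · rw [DiffPoly.natDegree, h0, Polynomial.natDegree_zero]
        omega
      · exact (Polynomial.natDegree_lt_iff_degree_lt h0).mpr hd
    · rw [← pow_succ, Nat.sub_add_cancel (by omega)]
      abel
  obtain ⟨s, hs, hfs⟩ := hs
  -- With m = deg f, the associator of tᵐ⁻¹, t and z suffices: tᵐ reduces to -s, so the two
  -- bracketings are the remainders of -sz and tᵐz, and these differ by that of fz. The bound m ≥ 2
  -- makes tᵐ⁻¹ and t their own remainders.
  have h1 := h (proj hf (t δ ^ (f.natDegree - 1))) (proj hf (t δ ^ 1)) (proj hf z)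
  have hl : ∀ k < f.natDegree, lift (proj hf (t δ ^ k)) = t δ ^ k := fun k hkf =>
    lift_proj (by rwa [hk])
  simp only [mul_def, proj_mul_right] at h1
  rw [hl _ (by omega), hl _ (by omega), pow_one, ← mul_assoc] at h1
  have h2 : proj hf (t δ ^ (f.natDegree - 1) * t δ) = proj hf (-s) := by
    rw [← sub_eq_zero, ← map_sub, sub_neg_eq_add, ← hfs, proj_eq_zero_iff]
    exact ⟨1, (one_mul f).symm⟩
  have hs' : (-s).natDegree = s.natDegree := Polynomial.natDegree_neg (toPoly s)
  rw [h2, lift_proj (by rwa [hs']), eq_comm, ← sub_eq_zero, ← map_sub, ← sub_mul,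
    sub_neg_eq_add, ← hfs] at h1
  exact h1

/-! Automorphisms given by conjugation with central elements that commute with `f`. -/
section conj

theorem const_units_inv_mul (u : (Subring.center D)ˣ) :
    const δ ((u⁻¹ : (Subring.center D)ˣ) : Subring.center D)
      * const δ ((u : Subring.center D) : D) = 1 := by
  rw [const_mul_const, ← Subring.coe_mul, ← Units.val_mul, inv_mul_cancel]
  rfl

theorem const_units_mul_inv (u : (Subring.center D)ˣ) :
    const δ ((u : Subring.center D) : D)
      * const δ ((u⁻¹ : (Subring.center D)ˣ) : Subring.center D) = 1 := by
  rw [const_mul_const, ← Subring.coe_mul, ← Units.val_mul, mul_inv_cancel]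
  rfl

/-- `p ↦ u⁻¹ p u` on the differential polynomial ring. -/
noncomputable def polyConj (u : (Subring.center D)ˣ) (p : DiffPoly δ) : DiffPoly δ :=
  const δ ((u⁻¹ : (Subring.center D)ˣ) : Subring.center D) * p
    * const δ ((u : Subring.center D) : D)

theorem polyConj_add (u : (Subring.center D)ˣ) (p q : DiffPoly δ) :
    polyConj u (p + q) = polyConj u p + polyConj u q := by
  rw [polyConj, mul_add, add_mul]
  rfl

theorem polyConj_mul (u : (Subring.center D)ˣ) (p q : DiffPoly δ) :
    polyConj u (p * q) = polyConj u p * polyConj u q := by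
  simp only [polyConj, mul_assoc]
  rw [← mul_assoc (const δ (u : D)) (const δ _), const_units_mul_inv, one_mul]

theorem polyConj_polyConj (u v : (Subring.center D)ˣ) (p : DiffPoly δ) :
    polyConj u (polyConj v p) = polyConj (u * v) p := by
  -- Nested conjugation gives (vu)⁻¹p(vu); the order can be swapped because central units commute.
  rw [mul_comm u v]
  simp only [polyConj, mul_inv_rev, Units.val_mul, Subring.coe_mul, ← const_mul_const, mul_assoc]

theorem polyConj_one (p : DiffPoly δ) : polyConj 1 p = p := by
  change const δ ((1⁻¹ : (Subring.center D)ˣ) : Subring.center D) * p * const δ 1 = p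
  rw [inv_one, const_one, mul_one]
  exact one_mul p

theorem natDegree_polyConj_le (u : (Subring.center D)ˣ) (p : DiffPoly δ) :
    (polyConj u p).natDegree ≤ p.natDegree := by
  refine (natDegree_mul_le _ _).trans ?_
  rw [natDegree_const, add_zero]
  refine (natDegree_mul_le _ _).trans ?_
  rw [natDegree_const, zero_add]

theorem lift_proj_polyConj (hf0 : 0 < f.natDegree) (u : (Subring.center D)ˣ)
    (x : PetitAlgebra f hf) : lift (proj hf (polyConj u (lift x))) = polyConj u (lift x) :=
  lift_proj ((natDegree_polyConj_le u _).trans_lt (natDegree_lift_lt hf0 x))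

/-- Conjugation maps the left ideal of `f` into itself, as u⁻¹(qf)u = (u⁻¹qu)f, so it is compatible
with taking remainders. -/
theorem proj_polyConj_proj (hfu : ∀ u : Subring.center D, f * const δ (u : D) = const δ (u : D) * f)
    (u : (Subring.center D)ˣ) (p : DiffPoly δ) :
    proj hf (polyConj u (lift (proj hf p))) = proj hf (polyConj u p) := by
  obtain ⟨q, hq⟩ := modR_spec hf p
  have hq' : p = q * f + lift (proj hf p) := hq
  rw [eq_comm, ← sub_eq_zero, ← map_sub]
  nth_rewrite 1 [hq']
  rw [polyConj_add, add_sub_cancel_right, proj_eq_zero_iff]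
  refine ⟨polyConj u q, ?_⟩
  simp only [polyConj, mul_assoc, hfu]

/-- `x ↦ u⁻¹ x u` as an automorphism of a Petit algebra. -/
noncomputable def conjEquiv (hf0 : 0 < f.natDegree)
    (hfu : ∀ u : Subring.center D, f * const δ (u : D) = const δ (u : D) * f)
    (u : (Subring.center D)ˣ) : RingAut (PetitAlgebra f hf) where
  toFun x := proj hf (polyConj u (lift x))
  invFun x := proj hf (polyConj u⁻¹ (lift x))
  left_inv x := by
    beta_reduce
    rw [lift_proj_polyConj hf0, polyConj_polyConj, inv_mul_cancel, polyConj_one, proj_lift]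
  right_inv x := by
    beta_reduce
    rw [lift_proj_polyConj hf0, polyConj_polyConj, mul_inv_cancel, polyConj_one, proj_lift]
  map_add' x y := by rw [map_add, polyConj_add, map_add]
  map_mul' x y := by
    rw [mul_def x y, proj_polyConj_proj hfu, polyConj_mul, mul_def, lift_proj_polyConj hf0,
      lift_proj_polyConj hf0]

/-- The homomorphism `u ↦ (x ↦ u⁻¹ x u)` to the automorphism group of a Petit algebra. -/
noncomputable def conjHom (hf : f.Monic) (hf0 : 0 < f.natDegree)
    (hfu : ∀ u : Subring.center D, f * const δ (u : D) = const δ (u : D) * f) :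
    (Subring.center D)ˣ →* nonassocAut δ.constField (PetitAlgebra f hf) where
  toFun u := ⟨conjEquiv hf0 hfu u, fun a x => by
    change proj hf (polyConj u (lift (a • x))) = a • proj hf (polyConj u (lift x))
    rw [smul_def a (proj hf _), proj_mul_right, lift_smul]
    simp only [polyConj, ← const_comm, mul_assoc]⟩
  map_one' := by
    refine Subtype.ext (RingEquiv.ext fun x => ?_)
    change proj hf (polyConj 1 (lift x)) = x
    rw [polyConj_one, proj_lift]
  map_mul' u v := by
    refine Subtype.ext (RingEquiv.ext fun x => ?_)
    change proj hf (polyConj (u * v) (lift x)) =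
      proj hf (polyConj u (lift (proj hf (polyConj v (lift x)))))
    rw [lift_proj_polyConj hf0, polyConj_polyConj]

/-- As deg f > 1, t is its own remainder; fixing it means tu = ut, that is, δ(u) = 0. Conversely, a
central constant commutes with all of D[t;δ]. -/
theorem mem_ker_conjHom (hf1 : 1 < f.natDegree) (hf0 : 0 < f.natDegree)
    (hfu : ∀ u : Subring.center D, f * const δ (u : D) = const δ (u : D) * f)
    (u : (Subring.center D)ˣ) :
    u ∈ (conjHom hf hf0 hfu).ker ↔ δ ((u : Subring.center D) : D) = 0 := by
  rw [MonoidHom.mem_ker]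
  constructor
  · intro h
    have ht : (t δ).natDegree = 1 := Polynomial.natDegree_X
    have h1 : proj hf (polyConj u (lift (proj hf (t δ)))) = proj hf (t δ) :=
      RingEquiv.congr_fun (congrArg Subtype.val h) (proj hf (t δ))
    have h2 := congrArg lift h1
    rw [lift_proj_polyConj hf0, lift_proj (by rwa [ht])] at h2
    have h3 := congrArg (const δ ((u : Subring.center D) : D) * ·) h2
    simp only [polyConj, ← mul_assoc, const_units_mul_inv, one_mul] at h3
    rw [t_mul_const, add_eq_left] at h3
    exact Polynomial.C_injective ((congrArg toPoly h3).trans Polynomial.C_0.symm)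
  · intro h
    refine Subtype.ext (RingEquiv.ext fun x => ?_)
    change proj hf (polyConj u (lift x)) = x
    rw [polyConj, mul_assoc, const_comm ⟨(u : Subring.center D), h⟩, ← mul_assoc]
    rw [const_units_inv_mul, one_mul, proj_lift]

end conj

end PetitAlgebra

/-! ### Logarithmic derivatives as a quotient of the units of the centre. -/

namespace RingDerivation

variable {D : Type*} [DivisionRing D]

/-- The logarithmic derivative `u ↦ δ(u)/u`. -/
noncomputable def logDeriv (δ : RingDerivation D) :
    (Subring.center D)ˣ →* Multiplicative δ.logDerivatives where
  toFun u := Multiplicative.ofAdd ⟨δ.onCenter u / u, u, u.ne_zero, rfl⟩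
  map_one' := by
    have h : δ.onCenter 1 = 0 := Subtype.ext δ.map_one_eq_zero
    refine congrArg Multiplicative.ofAdd (Subtype.ext ?_)
    change δ.onCenter 1 / 1 = 0
    rw [h, zero_div]
  map_mul' u v := by
    refine congrArg Multiplicative.ofAdd (Subtype.ext ?_)
    change δ.onCenter (u * v) / (u * v) = δ.onCenter u / u + δ.onCenter v / v
    have hu := u.ne_zero
    have hv := v.ne_zero
    rw [onCenter_mul]
    field_simp
    ring

theorem logDeriv_surjective (δ : RingDerivation D) : Function.Surjective δ.logDeriv := by
  rintro ⟨_, u, hu, rfl⟩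
  exact ⟨Units.mk0 u hu, rfl⟩

theorem mem_ker_logDeriv (δ : RingDerivation D) (u : (Subring.center D)ˣ) :
    u ∈ δ.logDeriv.ker ↔ δ ((u : Subring.center D) : D) = 0 := by
  rw [MonoidHom.mem_ker]
  have h1 : δ.logDeriv u = 1 ↔ δ.onCenter u / u = 0 := Subtype.ext_iff
  rw [h1, div_eq_zero_iff, or_iff_left u.ne_zero]
  exact Subtype.ext_iff

end RingDerivation

/-- If central units commute with `f`, the logarithmic derivatives embed into the automorphism
group of the Petit algebra of `f`. -/
theorem PetitAlgebra.exists_subgroup_equiv_logDerivatives {D : Type*} [DivisionRing D]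
    {δ : RingDerivation D} {f : DiffPoly δ} (hf : f.Monic) (hf1 : 1 < f.natDegree)
    (hfu : ∀ u : Subring.center D,
      f * DiffPoly.const δ (u : D) = DiffPoly.const δ (u : D) * f) :
    ∃ H : Subgroup (nonassocAut δ.constField (PetitAlgebra f hf)),
      Nonempty (Multiplicative δ.logDerivatives ≃* H) := by
  have hf0 : 0 < f.natDegree := by omega
  -- Both homomorphisms on C^× have the nonzero central constants as kernel, so their images are
  -- isomorphic by the first isomorphism theorem.
  have hk : δ.logDeriv.ker = (conjHom hf hf0 hfu).ker := by
    ext u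
    rw [δ.mem_ker_logDeriv, mem_ker_conjHom hf1]
  exact ⟨(conjHom hf hf0 hfu).range,
    ⟨(QuotientGroup.quotientKerEquivOfSurjective _ δ.logDeriv_surjective).symm.trans
      ((QuotientGroup.quotientMulEquivOfEq hk).trans (QuotientGroup.quotientKerEquivRange _))⟩⟩

/-! ### The algebra (D, δ, d): division, associativity and the final assembly. -/

open DiffPoly in
/-- `(D, δ, d)` is a division algebra if and only if `V₃(z) - cz ≠ d` for all `z`. -/
theorem GenDiffAlgebra.isNonassocDivision_iff {D : Type*} [DivisionRing D] [CharP D 3]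
    {δ : RingDerivation D} [FiniteDimensional δ.constField D] (c : δ.constField) (d : D) :
    IsNonassocDivision (GenDiffAlgebra δ c d) ↔ ∀ z : D, V δ 3 z - c * z - d ≠ 0 := by
  have h3 : (cubicPoly δ c d).natDegree = 3 := natDegree_cubicPoly _ _
  have hne := (cubicPoly_monic δ c d).ne_zero
  have hdeg1 : ∀ z, (t δ - const δ z).natDegree = 1 := fun z => Polynomial.natDegree_X_sub_C z
  rw [PetitAlgebra.isNonassocDivision_iff (by omega)]
  constructor
  · intro h z hz
    -- A vanishing remainder factors `f` as a quadratic times t - z, and these two factors are zero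
    -- divisors in the algebra.
    have e := cubicPoly_eq_mul_t_sub (δ := δ) c d z
    rw [hz, const_zero, add_zero] at e
    have hl : (t δ - const δ z) ^ 2 - const δ (c : D) ≠ 0 := by
      intro h0
      rw [h0, zero_mul] at e
      exact hne e
    have ht : t δ - const δ z ≠ 0 := by
      intro h0
      rw [h0, mul_zero] at e
      exact hne e
    have hd := (natDegree_mul hl ht).2
    rw [← e, h3, hdeg1] at hd
    have e1 := PetitAlgebra.lift_proj (hf := cubicPoly_monic δ c d)
      (p := (t δ - const δ z) ^ 2 - const δ (c : D)) (by omega)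
    have e2 := PetitAlgebra.lift_proj (hf := cubicPoly_monic δ c d)
      (p := t δ - const δ z) (by rw [hdeg1]; omega)
    refine h (PetitAlgebra.proj _ ((t δ - const δ z) ^ 2 - const δ (c : D)))
      (PetitAlgebra.proj _ (t δ - const δ z)) ?_ ?_ ?_
    · intro h0
      rw [h0, map_zero] at e1
      exact hl e1.symm
    · intro h0
      rw [h0, map_zero] at e2
      exact ht e2.symm
    · rw [PetitAlgebra.mul_def, e1, e2, PetitAlgebra.proj_eq_zero_iff]
      exact ⟨1, by rw [one_mul, ← e]⟩
  · intro h x y hx hy hxy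
    obtain ⟨q, hq⟩ := PetitAlgebra.proj_eq_zero_iff.mp hxy
    have hlt := PetitAlgebra.natDegree_lift_lt (hf := cubicPoly_monic δ c d) (by omega)
    rw [h3] at hlt
    -- Uniqueness of the remainder: a factorization through t - z would make this nonzero constant a
    -- one-sided multiple of t - z, which is either zero or of positive degree.
    have hcc : ∀ z b, (b = 0 ∨ b.natDegree ≠ 0) → b ≠ const δ (V δ 3 z - c * z - d) := by
      rintro z b hb rfl
      rcases hb with hb | hb
      · exact h z (Polynomial.C_injective ((congrArg toPoly hb).trans Polynomial.C_0.symm))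
      · exact hb (natDegree_const _)
    refine not_dvd_of_no_linear_factor hne h3 ?_ ?_ (PetitAlgebra.lift_ne_zero hx)
      (PetitAlgebra.lift_ne_zero hy) (hlt x) (hlt y) hq
    · intro z g e
      have e' := e.symm.trans (cubicPoly_eq_mul_t_sub (δ := δ) c d z)
      rw [← sub_eq_iff_eq_add', ← sub_mul] at e'
      refine hcc z _ ?_ e'
      by_cases h0 : g - ((t δ - const δ z) ^ 2 - const δ (c : D)) = 0
      · exact Or.inl (by rw [h0, zero_mul])
      · right
        rw [(natDegree_mul h0 (t_sub_const_ne_zero z)).2, hdeg1]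
        omega
    · intro z g e
      have e' := e.symm.trans (cubicPoly_eq_t_sub_mul (δ := δ) c d z)
      rw [← sub_eq_iff_eq_add', ← mul_sub] at e'
      refine hcc z _ ?_ e'
      by_cases h0 : g - ((t δ - const δ z) ^ 2 - const δ (c : D)) = 0
      · exact Or.inl (by rw [h0, mul_zero])
      · right
        rw [(natDegree_mul (t_sub_const_ne_zero z) h0).2, hdeg1]
        omega

open DiffPoly in
/-- If `δ³ = cδ`, then `(D, δ, d)` is associative if and only if `d` is a central constant. -/
theorem GenDiffAlgebra.assoc_iff {D : Type*} [DivisionRing D] [CharP D 3]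
    {δ : RingDerivation D} (c : δ.constField) (d : D) (hδ : ∀ x : D, δ (δ (δ x)) = c * δ x) :
    (∀ x y z : GenDiffAlgebra δ c d, x * y * z = x * (y * z)) ↔
      ∃ a : δ.constField, ((a : Subring.center D) : D) = d := by
  have h3 : (cubicPoly δ c d).natDegree = 3 := natDegree_cubicPoly _ _
  constructor
  · intro h
    -- By associativity fz has remainder zero, while a constant b is its own remainder. Taking z = t
    -- and then z constant turns the two commutator formulas into δ(d) = 0 and [a, d] = 0.
    have key : ∀ b : D, ∀ z w : DiffPoly δ, cubicPoly δ c d * z = w * cubicPoly δ c d + const δ b →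
        b = 0 := by
      intro b z w hz
      have h0 := PetitAlgebra.proj_mul_eq_zero_of_assoc (hf := cubicPoly_monic δ c d)
        (by omega) h z
      have h1 : PetitAlgebra.proj (cubicPoly_monic δ c d) (w * cubicPoly δ c d) = 0 :=
        PetitAlgebra.proj_eq_zero_iff.mpr ⟨w, rfl⟩
      rw [hz, map_add, h1, zero_add] at h0
      have h2 := congrArg PetitAlgebra.lift h0
      rw [PetitAlgebra.lift_proj (by rw [natDegree_const]; omega), map_zero] at h2
      exact Polynomial.C_injective ((congrArg toPoly h2).trans Polynomial.C_0.symm)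
    have hd : δ d = 0 := key _ _ _ (cubicPoly_mul_t c d)
    have hc : d ∈ Subring.center D := by
      rw [Subring.mem_center_iff]
      intro a
      have := key _ _ _ (cubicPoly_mul_const c d a)
      rwa [hδ, sub_self, zero_add, sub_eq_zero] at this
    exact ⟨⟨⟨d, hc⟩, hd⟩, rfl⟩
  · rintro ⟨a, rfl⟩
    have ha : δ (a : D) = 0 := a.2
    refine PetitAlgebra.mul_assoc_of_forall_comm fun p => ?_
    have hC : ∀ b, cubicPoly δ c a * const δ b = const δ b * cubicPoly δ c a := fun b => by
      rw [cubicPoly_mul_const, hδ, sub_self, zero_add, coe_constField_comm a, sub_self,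
        const_zero, add_zero]
    have ht : cubicPoly δ c a * t δ = t δ * cubicPoly δ c a := by
      rw [cubicPoly_mul_t, ha, const_zero, add_zero]
    exact forall_comm_of_comm_const_of_comm_t hC ht p

theorem mainTheorem7 {D : Type*} [DivisionRing D] [CharP D 3]
    [FiniteDimensional (Subring.center D) D]
    (n : ℕ) (hn : Module.finrank (Subring.center D) D = n ^ 2)
    (δ : RingDerivation D) (c : δ.constField)
    (hδ : minpoly δ.constField (δ.onCenter : Module.End δ.constField (Subring.center D))
      = Polynomial.X ^ 3 - Polynomial.C c * Polynomial.X)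
    (d : D) :
    -- `(D, δ, d)` is an `F`-algebra of dimension `9n²` (it is unital by its ring structure)
    (IsScalarTower δ.constField (GenDiffAlgebra δ c d) (GenDiffAlgebra δ c d) ∧
      SMulCommClass δ.constField (GenDiffAlgebra δ c d) (GenDiffAlgebra δ c d) ∧
      Module.finrank δ.constField (GenDiffAlgebra δ c d) = 9 * n ^ 2) ∧
    -- the division criterion
    (IsNonassocDivision (GenDiffAlgebra δ c d) ↔
      ∀ z : D, DiffPoly.V δ 3 z - c * z ≠ d ∧ DiffPoly.V δ 3 z - z * c - d + δ c ≠ 0) ∧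
    -- the associativity criterion, when `g(δ) = 0` on the whole of `D`
    ((∀ x : D, δ (δ (δ x)) = c * δ x) →
      ((∀ x y z : GenDiffAlgebra δ c d, x * y * z = x * (y * z)) ↔
        ∃ a : δ.constField, ((a : Subring.center D) : D) = d)) ∧
    -- the automorphism group
    (∃ H : Subgroup (nonassocAut δ.constField (GenDiffAlgebra δ c d)),
      Nonempty (Multiplicative δ.logDerivatives ≃* H)) := by 
  have hC := RingDerivation.finrank_center hδ
  have : FiniteDimensional δ.constField (Subring.center D) :=
    Module.finite_of_finrank_pos (by omega)
  have : FiniteDimensional δ.constField D := Module.Finite.trans (Subring.center D) D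
  have hD : Module.finrank δ.constField D = 3 * n ^ 2 := by
    rw [← Module.finrank_mul_finrank δ.constField (Subring.center D) D, hC, hn]
  have h3 : (cubicPoly δ c d).natDegree = 3 := DiffPoly.natDegree_cubicPoly _ _
  refine ⟨⟨inferInstance, inferInstance, ?_⟩, ?_, GenDiffAlgebra.assoc_iff c d, ?_⟩
  · rw [PetitAlgebra.finrank_eq, h3, hD]
    ring
  · have hc : δ ((c : Subring.center D) : D) = 0 := c.2
    rw [GenDiffAlgebra.isNonassocDivision_iff]
    refine forall_congr' fun z => ?_
    -- With δ(c) = 0 and cz = zc the two inequalities coincide.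
    rw [hc, add_zero, ← DiffPoly.coe_constField_comm c z, ← sub_ne_zero (b := d), and_self_iff]
  · refine PetitAlgebra.exists_subgroup_equiv_logDerivatives _ (by omega) fun u => ?_
    -- The minimum polynomial gives this on the centre only, which is enough here: as u also
    -- commutes with d, it commutes with `f`.
    have hu : δ (δ (δ u)) = c * δ u :=
      congrArg Subtype.val (RingDerivation.onCenter_pow_three hδ u)
    rw [DiffPoly.cubicPoly_mul_const, hu, sub_self, zero_add,
      Subring.mem_center_iff.mp u.2 d, sub_self, DiffPoly.const_zero, add_zero]
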